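/- Valuations are considered up to equivalence, i.e. identified with their valuation rings. For a valuation $v$ on a field $K$ write $\mathcal{O}_v$ for its valuation ring and $Kv$ for its residue field; $v$ is finer than $w$ (and $w$ coarser than $v$) if $\mathcal{O}_v\subseteq\mathcal{O}_w$; $v$ is henselian if $\mathcal{O}_v$ is a henselian local ring. Let $H_1(K)$ (respectively $H_2(K)$) be the set of henselian valuations $v$ on $K$, the trivial one included, such that $Kv$ is not separably closed (respectively, is separably closed). The canonical henselian valuation $v_K$ of $K$ is the coarsest element of $H_2(K)$ if $H_2(K)\neq\emptyset$, and the finest element of $H_1(K)$ otherwise. A field $F$ is called $t$-henselian if there is a field $L$, elementarily equivalent to $F$ in the language of rings $\mathcal{L}_{\rm ring}$, that admits a non-trivial henselian valuation. An $\exists\forall$-formula is a formula of the form $\exists x_1\dots\exists x_m\forall y_1\dots\forall y_n\,\psi$ with $\psi$ quantifier-free and $m,n\ge 0$. Proposition. Let $K$ be a field with $v_K\in H_1(K)$ such that the residue field $Kv_K$ is not $t$-henselian. Then $v_K$ is $\emptyset$-definable as such by an $\exists\forall$-formula, uniformly over the elementary class of $(K,v_K)$. That is, there is a parameter-free $\exists\forall$-formula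 $\phi(x)$ of $\mathcal{L}_{\rm ring}$ such that (1) for every field $L\equiv K$ (in $\mathcal{L}_{\rm ring}$), $L$ has a canonical henselian valuation $v_L$ and $\phi(L)=\mathcal{O}_{v_L}$; and (2) for every valued field $(L,w)$ that is elementarily equivalent to $(K,v_K)$ in the language $\mathcal{L}_{\rm ring}$ together with a unary predicate for the valuation ring, $\phi(L)=\mathcal{O}_w$. -/

import Mathlib

universe u v

noncomputable section

namespace CanonicalHenselian

open FirstOrder FirstOrder.Language

/-! ### Henselian valuations and the canonical henselian valuation

Valuations on a field `K` are taken up to equivalence, that is, they are given by their valuation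
rings `v : ValuationSubring K`; `v ≤ w` means that `v` is finer than `w`, and the trivial valuation
is `⊤`. -/

/-- `H₁(K)`: the henselian valuations on `K` whose residue field is not separably closed. -/
def H₁ (K : Type*) [Field K] : Set (ValuationSubring K) :=
  {v | HenselianLocalRing v ∧ ¬ IsSepClosed (IsLocalRing.ResidueField v)}

/-- `H₂(K)`: the henselian valuations on `K` whose residue field is separably closed. -/
def H₂ (K : Type*) [Field K] : Set (ValuationSubring K) :=
  {v | HenselianLocalRing v ∧ IsSepClosed (IsLocalRing.ResidueField v)}

/-- `v` is the canonical henselian valuation on `K`: the coarsest element of `H₂(K)` if `H₂(K)` is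
non-empty, and the finest element of `H₁(K)` otherwise. -/
def IsCanonical {K : Type*} [Field K] (v : ValuationSubring K) : Prop :=
  ((H₂ K).Nonempty ∧ IsGreatest (H₂ K) v) ∨ (¬ (H₂ K).Nonempty ∧ IsLeast (H₁ K) v)

theorem IsCanonical.unique {K : Type*} [Field K] {v w : ValuationSubring K}
    (hv : IsCanonical v) (hw : IsCanonical w) : v = w := by
  rcases hv with ⟨h, hv⟩ | ⟨h, hv⟩ <;> rcases hw with ⟨h', hw⟩ | ⟨h', hw⟩
  · exact hv.unique hw
  · exact absurd h h'
  · exact absurd h' h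
  · exact hv.unique hw

/-- A field is henselian if it admits some non-trivial henselian valuation. -/
def IsHenselianField (K : Type*) [Field K] : Prop :=
  ∃ v : ValuationSubring K, v ≠ ⊤ ∧ HenselianLocalRing v

/-! ### Elementary equivalence of fields and of valued fields -/

/-- Elementary equivalence of fields in the language of rings. -/
def FieldEquiv (K L : Type*) [Field K] [Field L] : Prop :=
  letI := Ring.compatibleRingOfRing K
  letI := Ring.compatibleRingOfRing L
  K ≅[Language.ring] L

/-- A field is t-henselian if it is elementarily equivalent to a henselian field.
(By the Löwenheim–Skolem theorem, the universe in which the latter is sought is irrelevant.) -/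
def IsTHenselian (F : Type u) [Field F] : Prop :=
  ∃ (L : Type u) (_ : Field L), FieldEquiv F L ∧ IsHenselianField L

/-- The relation symbols of the language with a single unary predicate symbol. -/
inductive PredRel : ℕ → Type
  | mem : PredRel 1

/-- The language with a single unary predicate symbol and nothing else. -/
def predLang : Language := ⟨fun _ => Empty, PredRel⟩

/-- The language of rings together with a unary predicate symbol for the valuation ring. -/
abbrev valuedLang : Language := Language.ring.sum predLang

/-- The interpretation of the unary predicate symbol by the set `S`. -/
abbrev predStructure {K : Type*} (S : Set K) : predLang.Structure K where
  funMap := fun f => f.elim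
  RelMap := fun r => match r with
    | PredRel.mem => fun x => x 0 ∈ S

/-- The valued field `(K, v)` as a structure: the field `K` with its ring operations and the
predicate symbol interpreted by the valuation ring of `v`. -/
abbrev valuedStructure {K : Type*} [Field K] (v : ValuationSubring K) : valuedLang.Structure K :=
  letI := Ring.compatibleRingOfRing K
  letI := predStructure (v : Set K)
  Language.sumStructure Language.ring predLang K

/-- Elementary equivalence `(K, v) ≡ (L, w)` of valued fields. -/
def ValuedFieldEquiv {K L : Type*} [Field K] [Field L]
    (v : ValuationSubring K) (w : ValuationSubring L) : Prop :=
  letI := valuedStructure v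
  letI := valuedStructure w
  K ≅[valuedLang] L

/-! ### Definability -/

/-- `∃∀`-formulas: `∃ x₁ … xₘ ∀ y₁ … yₙ ψ` with `ψ` quantifier-free (`m` and `n` may be `0`). -/
inductive IsExistsForall {Lang : Language} {α : Type*} :
    ∀ {n : ℕ}, Lang.BoundedFormula α n → Prop
  | of_isUniversal {n : ℕ} {φ : Lang.BoundedFormula α n} (h : φ.IsUniversal) : IsExistsForall φ
  | ex {n : ℕ} {φ : Lang.BoundedFormula α (n + 1)} (h : IsExistsForall φ) : IsExistsForall φ.ex

/-- The subset `φ(K)` of the field `K` that is defined by the parameter-free formula `φ(x)` in the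
language of rings. -/
def definedSet (φ : Language.ring.Formula (Fin 1)) (K : Type*) [Field K] : Set K :=
  letI := Ring.compatibleRingOfRing K
  {x | φ.Realize (fun _ => x)}

end CanonicalHenselian

end

/-!
Write `Σ` for the theory of the valued field `(K, vK)`. The residue field of `vK` is neither
separably closed nor, since it is not t-henselian, elementarily equivalent to a henselian field.
So in every model `(F, u)` of `Σ` the valuation `u` is henselian, with a residue field that is
neither separably closed nor henselian, because the residue field is interpretable in the valued
field.

Such a valuation `u` is finer than every henselian valuation `w` on `F` (`le_of_henselian`). Indeed,
if `w` is strictly finer than `u`, then it induces a non-trivial henselian valuation on the residue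
field of `u`. If `u` and `w` are incomparable, then the residue field of `u` is algebraically closed
(`isAlgClosed_residueField_of_incomparable`): a monic polynomial over it can be lifted to a
polynomial over `F` that reduces modulo `w` to `X ^ n - X ^ (n - 1)`, and the latter has the simple
root `1`, which lifts to a root in `F`. In particular `u` is the canonical henselian valuation.

Now let `(F, u)` and `(F', u')` be models of `Σ` such that `F` is a relatively algebraically closed
subfield of `F'`. The restriction of `u'` to `F` is henselian (`henselianLocalRing_comap`), hence it
is coarser than `u`, that is, the valuation ring of `u` is contained in that of `u'`. The hypothesis
on `F` and `F'` says that `F'` satisfies certain universal formulas with names for the elements of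
`F`. So compactness yields for each element `c` of the valuation ring of a model an `∃∀`-formula of
the language of rings that holds for `c` and implies membership in the valuation ring in all models
(`exists_isExistsForallType_of_mem`). By compactness again, finitely many such formulas cover the
valuation rings of all models, and their disjunction defines the valuation ring
(`exists_defining_formula`). This is a preservation theorem in the style of Prestel.

Let `φ` be the defining formula. That `φ` defines the valuation ring is a sentence of `Σ`, hence it
holds in all models. If a field `L` is elementarily equivalent to `K`, then `(L, φ(L))` is
elementarily equivalent to `(K, φ(K))` and so is a model of `Σ`, whose valuation is canonical.

To express algebraic conditions by formulas, `SameDef` relates predicates on two structures that are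
defined by one formula, without naming the formula. As the two structures may live in different
universes, this serves to transfer properties along elementary equivalences. The compactness theorem
provides models in `Type`, and the formulas are only compared on those; this is enough because `Σ`
is complete.
-/

universe w

noncomputable section

namespace CanonicalHenselian

open IsLocalRing Polynomial

variable {K : Type*} [Field K]

/-! ### Henselian local rings -/

/-- A homomorphic image of a henselian local ring is henselian. -/
theorem henselianLocalRing_of_surjective {R S : Type*} [CommRing R] [CommRing S] [Nontrivial S]
    [HenselianLocalRing R] (f : R →+* S) (hf : Function.Surjective f) : HenselianLocalRing S := by
  have : IsLocalHom f := IsLocalHom.of_surjective f hf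
  have : IsLocalRing S := IsLocalRing.of_surjective f hf
  refine ⟨fun p hp a₀ h₁ h₂ => ?_⟩
  obtain ⟨q, rfl, -, hq⟩ := lifts_and_natDegree_eq_and_monic
    (mem_lifts_of_surjective hf p) hp
  obtain ⟨a, rfl⟩ := hf a₀
  rw [eval_map, eval₂_at_apply] at h₁
  rw [derivative_map, eval_map, eval₂_at_apply] at h₂
  obtain ⟨b, hb, hba⟩ := HenselianLocalRing.is_henselian q hq a
    (fun h => h₁ (h.map f)) (isUnit_of_map_unit f _ h₂)
  refine ⟨f b, ?_, ?_⟩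
  · rw [IsRoot, eval_map, eval₂_at_apply, hb.eq_zero, map_zero]
  · rw [← map_sub]
    exact fun h => hba (isUnit_of_map_unit f _ h)

/-- A simple root of the reduction of a monic polynomial over a henselian ring lifts. -/
theorem exists_root_of_residue {R : Type*} [CommRing R] [HenselianLocalRing R] {f : R[X]}
    (hf : f.Monic) (a : R) (h₁ : (f.map (residue R)).eval (residue R a) = 0)
    (h₂ : (f.map (residue R)).derivative.eval (residue R a) ≠ 0) : ∃ b : R, f.eval b = 0 := by
  rw [eval_map, eval₂_at_apply, residue_eq_zero_iff] at h₁
  rw [derivative_map, eval_map, eval₂_at_apply, residue_ne_zero_iff_isUnit] at h₂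
  obtain ⟨b, hb, -⟩ := HenselianLocalRing.is_henselian f hf a h₁ h₂
  exact ⟨b, hb⟩

/-! ### Incomparable valuation rings -/

theorem valuation_add_one_of_lt {v : ValuationSubring K} {t : K} (ht : v.valuation t < 1) :
    v.valuation (1 + t) = 1 := by
  simpa using v.valuation.map_one_add_of_lt ht

/-- Two incomparable valuation rings have an element `t` that is small for one valuation and
large for the other one. -/
theorem exists_lt_one_and_one_lt {v w : ValuationSubring K} (h₁ : ¬ v ≤ w) (h₂ : ¬ w ≤ v) :
    ∃ t, v.valuation t < 1 ∧ 1 < w.valuation t := by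
  obtain ⟨x, hxv, hxw⟩ := SetLike.not_le_iff_exists.1 h₁
  obtain ⟨y, hyw, hyv⟩ := SetLike.not_le_iff_exists.1 h₂
  rw [← ValuationSubring.valuation_le_one_iff] at hxv hyw
  rw [← ValuationSubring.valuation_le_one_iff, not_le] at hxw hyv
  have hy0 : y ≠ 0 := by rintro rfl; simp at hyv
  refine ⟨x / y, ?_, ?_⟩
  · rw [map_div₀, div_lt_one₀ (zero_lt_one.trans hyv)]
    exact hxv.trans_lt hyv
  · rw [map_div₀, one_lt_div₀ ((Valuation.pos_iff _).2 hy0)]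
    exact hyw.trans_lt hxw

/-- For incomparable valuation rings, there is an element that is close to `1` for one valuation and
close to `0` for the other one. -/
theorem exists_sub_one_lt_and_lt {v w : ValuationSubring K} (h₁ : ¬ v ≤ w) (h₂ : ¬ w ≤ v) :
    ∃ e, v.valuation (e - 1) < 1 ∧ w.valuation e < 1 := by
  obtain ⟨t, htv, htw⟩ := exists_lt_one_and_one_lt h₁ h₂
  have hv : v.valuation (1 + t) = 1 := valuation_add_one_of_lt htv
  have hw : w.valuation (1 + t) = w.valuation t :=
    w.valuation.map_add_eq_of_lt_right (by rw [map_one]; exact htw)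
  have h0 : 1 + t ≠ 0 := by
    intro h; rw [h, map_zero] at hv; exact zero_ne_one hv
  refine ⟨(1 + t)⁻¹, ?_, ?_⟩
  · rw [show (1 + t)⁻¹ - 1 = -t / (1 + t) by field_simp; ring, map_div₀, hv, div_one,
      Valuation.map_neg]
    exact htv
  · rw [map_inv₀, hw]
    exact inv_lt_one_of_one_lt₀ htw

/-- For incomparable valuation rings, every residue class of the one contains an element that is
close to `0` for the other one. -/
theorem exists_sub_lt_and_lt {v w : ValuationSubring K} (h₁ : ¬ v ≤ w) (h₂ : ¬ w ≤ v) {a : K}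
    (ha : a ∈ v) : ∃ b, v.valuation (b - a) < 1 ∧ w.valuation b < 1 := by
  rw [← ValuationSubring.valuation_le_one_iff] at ha
  by_cases haw : w.valuation a ≤ 1
  · obtain ⟨e, hev, hew⟩ := exists_sub_one_lt_and_lt h₁ h₂
    refine ⟨a * e, ?_, ?_⟩
    · rw [show a * e - a = a * (e - 1) by ring, map_mul]
      exact (mul_le_of_le_one_left' ha).trans_lt hev
    · rw [map_mul]
      exact (mul_le_of_le_one_left' haw).trans_lt hew
  · obtain ⟨t, htv, htw⟩ := exists_lt_one_and_one_lt h₁ h₂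
    rw [not_le] at haw
    have hat : v.valuation (a * t) < 1 := by
      rw [map_mul]; exact (mul_le_of_le_one_left' ha).trans_lt htv
    have hv : v.valuation (1 + a * t) = 1 := valuation_add_one_of_lt hat
    have hatw : w.valuation a < w.valuation (a * t) := by
      rw [map_mul]
      exact lt_mul_of_one_lt_right (zero_lt_one.trans haw) htw
    have hw : w.valuation (1 + a * t) = w.valuation (a * t) :=
      w.valuation.map_add_eq_of_lt_right (by rw [map_one]; exact haw.trans hatw)
    have h0 : 1 + a * t ≠ 0 := by
      intro h; rw [h, map_zero] at hv; exact zero_ne_one hv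
    refine ⟨a / (1 + a * t), ?_, ?_⟩
    · rw [show a / (1 + a * t) - a = -(a * (a * t)) / (1 + a * t) by field_simp; ring, map_div₀, hv,
        div_one, Valuation.map_neg, map_mul]
      exact (mul_le_of_le_one_left' ha).trans_lt hat
    · rw [map_div₀, hw, div_lt_one₀ (zero_lt_one.trans (haw.trans hatw))]
      exact hatw

theorem residue_eq_iff_valuation_sub_lt_one {v : ValuationSubring K} (a b : v) :
    residue v a = residue v b ↔ v.valuation (a - b : K) < 1 := by
  rw [← sub_eq_zero, ← map_sub, residue_eq_zero_iff, ValuationSubring.valuation_lt_one_iff]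
  rfl

/-- The polynomial `X ^ n + ∑ i < n, c i * X ^ i`. -/
def monicOf {R : Type*} [CommRing R] {n : ℕ} (c : Fin n → R) : R[X] :=
  X ^ n + ∑ i, C (c i) * X ^ (i : ℕ)

theorem monic_monicOf {R : Type*} [CommRing R] [Nontrivial R] {n : ℕ} (c : Fin n → R) :
    (monicOf c).Monic := by
  refine monic_X_pow_add ?_
  refine (degree_sum_le _ _).trans_lt ?_
  refine (Finset.sup_lt_iff (WithBot.bot_lt_coe n)).2 fun i _ => ?_
  exact (degree_C_mul_X_pow_le _ _).trans_lt (Nat.cast_lt.2 i.2)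

theorem natDegree_monicOf {R : Type*} [CommRing R] [Nontrivial R] {n : ℕ} (c : Fin n → R) :
    (monicOf c).natDegree = n := by
  refine natDegree_eq_of_degree_eq_some ?_
  rw [monicOf, degree_add_eq_left_of_degree_lt, degree_X_pow]
  rw [degree_X_pow]
  refine (degree_sum_le _ _).trans_lt ?_
  refine (Finset.sup_lt_iff (WithBot.bot_lt_coe n)).2 fun i _ => ?_
  exact (degree_C_mul_X_pow_le _ _).trans_lt (Nat.cast_lt.2 i.2)

theorem map_monicOf {R S : Type*} [CommRing R] [CommRing S] (f : R →+* S) {n : ℕ} (c : Fin n → R) :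
    (monicOf c).map f = monicOf (fun i => f (c i)) := by
  simp [monicOf, Polynomial.map_sum]

theorem eval_monicOf_map {R S : Type*} [CommRing R] [CommRing S] (f : R →+* S) {n : ℕ}
    (c : Fin n → R) (x : R) : (monicOf fun i => f (c i)).eval (f x) = f ((monicOf c).eval x) := by
  rw [← map_monicOf, eval_map, eval₂_at_apply]

theorem eq_monicOf {R : Type*} [CommRing R] {f : R[X]} (hf : f.Monic) {n : ℕ}
    (hn : f.natDegree = n) : f = monicOf fun i : Fin n => f.coeff i := by
  subst hn
  rw [monicOf, Fin.sum_univ_eq_sum_range fun i => C (f.coeff i) * X ^ i]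
  exact hf.as_sum

/-- A valuation ring contains the roots of the monic polynomials over it. -/
theorem mem_of_monic_root {v : ValuationSubring K} {f : v[X]} (hf : f.Monic) {y : K}
    (hy : (f.map v.subtype).eval y = 0) : y ∈ v := by
  have : IsIntegral v y := ⟨f, hf, by rwa [eval_map] at hy⟩
  obtain ⟨z, rfl⟩ := IsIntegrallyClosed.isIntegral_iff.1 this
  exact z.2

/-- If a henselian valuation `w` is incomparable to a valuation `v`, then the residue field of `v`
is algebraically closed: a polynomial over it lifts to one that is close, with respect to `w`, to
`X ^ n - X ^ (n - 1)`, and so has a root. -/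
theorem isAlgClosed_residueField_of_incomparable {v w : ValuationSubring K}
    [HenselianLocalRing w] (h₁ : ¬ v ≤ w) (h₂ : ¬ w ≤ v) : IsAlgClosed (ResidueField v) := by
  refine IsAlgClosed.of_exists_root _ fun p hp hirr => ?_
  obtain ⟨k, hk⟩ : ∃ k, p.natDegree = k + 1 :=
    Nat.exists_eq_succ_of_ne_zero hirr.natDegree_pos.ne'
  obtain ⟨e, hev, hew⟩ := exists_sub_one_lt_and_lt h₂ h₁
  -- coefficients that lift those of `p` and reduce to those of `X ^ (k + 1) - X ^ k` modulo the
  -- maximal ideal of `w`; the latter polynomial has the simple root `1`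
  have key : ∀ i, ∃ c : K, ∃ hv : c ∈ v, ∃ hw : c ∈ w, residue v ⟨c, hv⟩ = p.coeff i ∧
      residue w ⟨c, hw⟩ = if i = k then -1 else 0 := by
    intro i
    obtain ⟨a, ha⟩ := residue_surjective (p.coeff i)
    obtain ⟨b, hbv, hbw⟩ := exists_sub_lt_and_lt h₁ h₂ a.2
    have hbv' : b ∈ v := by
      have := v.add_mem _ _ (v.mem_of_valuation_le_one _ hbv.le) a.2
      simpa using this
    have hbw' : b ∈ w := w.mem_of_valuation_le_one _ hbw.le
    have he : e ∈ v := v.mem_of_valuation_le_one _ hew.le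
    have he' : e ∈ w := by
      have := w.add_mem _ _ (w.mem_of_valuation_le_one _ hev.le) w.one_mem
      simpa using this
    by_cases hik : i = k
    · refine ⟨b - e, sub_mem hbv' he, sub_mem hbw' he', ?_, ?_⟩
      · rw [← ha, residue_eq_iff_valuation_sub_lt_one]
        change v.valuation (b - e - a) < 1
        rw [show b - e - a = (b - a) - e by ring]
        exact v.valuation.map_sub_lt hbv hew
      · rw [if_pos hik, ← map_one (residue w), ← map_neg, residue_eq_iff_valuation_sub_lt_one]
        change w.valuation (b - e - -1) < 1
        rw [show b - e - -1 = b - (e - 1) by ring]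
        exact w.valuation.map_sub_lt hbw hev
    · refine ⟨b, hbv', hbw', ?_, ?_⟩
      · rw [← ha, residue_eq_iff_valuation_sub_lt_one]
        exact hbv
      · rw [if_neg hik, ← map_zero (residue w), residue_eq_iff_valuation_sub_lt_one]
        simpa using hbw
  choose c hcv hcw hv hw using key
  have hmap : (monicOf fun i : Fin (k + 1) => (⟨c i, hcw i⟩ : w)).map (residue w) =
      X ^ (k + 1) - X ^ k := by
    rw [map_monicOf]
    simp only [hw, monicOf]
    rw [Fin.sum_univ_castSucc, Finset.sum_eq_zero fun i _ => by
      rw [Fin.val_castSucc, if_neg i.2.ne, C_0, zero_mul]]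
    simp [sub_eq_add_neg]
  obtain ⟨y, hy⟩ := exists_root_of_residue
    (monic_monicOf fun i : Fin (k + 1) => (⟨c i, hcw i⟩ : w)) 1
    (by rw [hmap]; simp) (by rw [hmap]; simp [derivative_X_pow])
  have hy' : (monicOf fun i : Fin (k + 1) => c i).eval (y : K) = 0 := by
    have := eval_monicOf_map w.subtype (fun i : Fin (k + 1) => (⟨c i, hcw i⟩ : w)) y
    rw [hy, map_zero] at this
    exact this
  have hyv : (y : K) ∈ v := by
    refine mem_of_monic_root (monic_monicOf fun i : Fin (k + 1) => (⟨c i, hcv i⟩ : v)) ?_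
    rw [map_monicOf]
    exact hy'
  refine ⟨residue v ⟨y, hyv⟩, ?_⟩
  have hy'' : (monicOf fun i : Fin (k + 1) => (⟨c i, hcv i⟩ : v)).eval ⟨y, hyv⟩ = 0 := by
    refine Subtype.val_injective ?_
    change v.subtype _ = _
    rw [← eval_monicOf_map]
    exact hy'
  have : p = (monicOf fun i : Fin (k + 1) => (⟨c i, hcv i⟩ : v)).map (residue v) := by
    rw [map_monicOf]
    simp only [hv]
    exact eq_monicOf hp hk
  rw [this, eval_map, eval₂_at_apply, hy'', map_zero]

end CanonicalHenselian

namespace CanonicalHenselian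

open IsLocalRing Polynomial

variable {K : Type*} [Field K]

theorem IsSepClosed.of_ringEquiv {k k' : Type*} [Field k] [Field k'] (e : k ≃+* k')
    [IsSepClosed k] : IsSepClosed k' := by
  refine IsSepClosed.of_exists_root _ fun p _ hirr hsep => ?_
  obtain ⟨x, hx⟩ := IsSepClosed.exists_root (p.map e.symm.toRingHom)
    (by rw [degree_map]; exact hirr.degree_pos.ne') hsep.map
  refine ⟨e x, e.symm.injective ?_⟩
  rw [IsRoot, eval_map] at hx
  have : e.symm.toRingHom (eval (e x) p) = eval₂ e.symm.toRingHom (e.symm.toRingHom (e x)) p :=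
    (eval₂_at_apply _ _).symm
  rw [map_zero, ← hx]
  simpa using this

/-! ### Coarsenings and refinements -/

/-- The valuation ring that `w` induces on the residue field of a coarser valuation `v`. -/
def inducedValuationSubring (v w : ValuationSubring K) (h : w ≤ v) :
    ValuationSubring (ResidueField v) :=
  ValuationSubring.ofSubring ((residue v).comp (ValuationSubring.inclusion w v h)).range fun x => by
    obtain ⟨y, rfl⟩ := residue_surjective x
    rcases w.mem_or_inv_mem y with hy | hy
    · exact Or.inl ⟨⟨y, hy⟩, rfl⟩
    · rcases eq_or_ne y 0 with rfl | hy0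
      · exact Or.inl ⟨0, by simp⟩
      · refine Or.inr ⟨⟨_, hy⟩, ?_⟩
        refine eq_inv_of_mul_eq_one_left ?_
        have : (ValuationSubring.inclusion w v h ⟨_, hy⟩) * y = 1 := by
          refine Subtype.val_injective (inv_mul_cancel₀ ?_)
          simpa using hy0
        rw [RingHom.comp_apply, ← map_mul, this, map_one]

/-- The reduction map from `w` to the valuation ring that it induces on the residue field of `v`. -/
def toInduced (v w : ValuationSubring K) (h : w ≤ v) : w →+* inducedValuationSubring v w h :=
  ((residue v).comp (ValuationSubring.inclusion w v h)).rangeRestrict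

theorem toInduced_surjective (v w : ValuationSubring K) (h : w ≤ v) :
    Function.Surjective (toInduced v w h) :=
  ((residue v).comp (ValuationSubring.inclusion w v h)).rangeRestrict_surjective

theorem inducedValuationSubring_ne_top {v w : ValuationSubring K} (h : w < v) :
    inducedValuationSubring v w h.le ≠ ⊤ := by
  obtain ⟨x, hxv, hxw⟩ := SetLike.not_le_iff_exists.1 h.not_ge
  intro htop
  have : residue v ⟨x, hxv⟩ ∈ inducedValuationSubring v w h.le := by
    rw [htop]; exact ValuationSubring.mem_top _
  obtain ⟨y, hy⟩ := this
  have hy' := (residue_eq_iff_valuation_sub_lt_one _ _).1 hy.symm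
  -- `x - y` lies in the maximal ideal of `v`, hence in that of `w`
  have hmem : (x - y : K) ∈ v.nonunits := hy'
  have := w.add_mem _ _ (w.nonunits_le (ValuationSubring.nonunits_le_nonunits.2 h.le hmem)) y.2
  exact hxw (by simpa using this)

/-- A proper henselian refinement of `v` induces a non-trivial henselian valuation on the residue
field of `v`. -/
theorem isHenselianField_residueField_of_lt {v w : ValuationSubring K} [HenselianLocalRing w]
    (h : w < v) : IsHenselianField (ResidueField v) :=
  ⟨inducedValuationSubring v w h.le, inducedValuationSubring_ne_top h,
    henselianLocalRing_of_surjective _ (toInduced_surjective v w h.le)⟩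

theorem IsHenselianField.of_ringEquiv {k k' : Type*} [Field k] [Field k'] (e : k ≃+* k')
    (h : IsHenselianField k) : IsHenselianField k' := by
  obtain ⟨v, hv, hens⟩ := h
  have hmem : ∀ x, x ∈ v ↔ e x ∈ v.comap e.symm.toRingHom := fun x => by
    rw [ValuationSubring.mem_comap]; simp
  refine ⟨v.comap e.symm.toRingHom, fun htop => hv ?_, ?_⟩
  · refine eq_top_iff.2 fun x _ => (hmem x).2 ?_
    rw [htop]; exact ValuationSubring.mem_top _
  · refine henselianLocalRing_of_surjective (((e : k →+* k').comp v.subtype).codRestrict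
      (v.comap e.symm.toRingHom).toSubring fun x => (hmem x).1 x.2) fun y => ?_
    exact ⟨⟨e.symm y, y.2⟩, Subtype.val_injective (e.apply_symm_apply _)⟩

/-- A valuation whose residue field is neither separably closed nor henselian is finer than every
henselian valuation. -/
theorem le_of_henselian {v w : ValuationSubring K} (hw : HenselianLocalRing w)
    (hsep : ¬ IsSepClosed (ResidueField v)) (hhens : ¬ IsHenselianField (ResidueField v)) :
    v ≤ w := by
  by_contra hvw
  by_cases hwv : w ≤ v
  · exact hhens (isHenselianField_residueField_of_lt (lt_of_le_not_ge hwv hvw))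
  · have := isAlgClosed_residueField_of_incomparable hvw hwv
    exact hsep inferInstance

/-- The residue field of a valuation on a separably closed field is separably closed. -/
theorem isSepClosed_residueField [IsSepClosed K] (v : ValuationSubring K) :
    IsSepClosed (ResidueField v) := by
  refine IsSepClosed.of_exists_root _ fun p hp hirr hsep => ?_
  obtain ⟨f, rfl, hdeg, hf⟩ := lifts_and_natDegree_eq_and_monic
    (mem_lifts_of_surjective residue_surjective p) hp
  have hfirr : Irreducible (f.map (algebraMap v K)) :=
    hf.irreducible_iff_irreducible_map_fraction_map.1 (hf.irreducible_of_irreducible_map _ _ hirr)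
  -- an inseparable irreducible polynomial has derivative zero, and then so has its reduction
  have hfsep : (f.map (algebraMap v K)).Separable := by
    rw [separable_iff_derivative_ne_zero hfirr, derivative_map]
    intro h0
    have h1 : derivative f = 0 :=
      map_injective _ (IsFractionRing.injective v K) (by rw [h0, Polynomial.map_zero])
    rw [separable_iff_derivative_ne_zero hirr, derivative_map, h1, Polynomial.map_zero] at hsep
    exact hsep rfl
  obtain ⟨x, hx⟩ := IsSepClosed.exists_root _ hfirr.degree_pos.ne' hfsep
  have hxv : x ∈ v := mem_of_monic_root hf hx
  refine ⟨residue v ⟨x, hxv⟩, ?_⟩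
  rw [eval_map, eval₂_at_apply]
  have : eval ⟨x, hxv⟩ f = 0 := by
    refine Subtype.val_injective ?_
    change v.subtype (eval ⟨x, hxv⟩ f) = 0
    rw [← eval₂_at_apply, ← eval_map]
    exact hx
  rw [this, map_zero]

/-- If a coarsening of `v` has separably closed residue field, then so has `v`. -/
theorem isSepClosed_residueField_of_le {v w : ValuationSubring K} (h : v ≤ w)
    [IsSepClosed (ResidueField w)] : IsSepClosed (ResidueField v) := by
  have hsurj := toInduced_surjective w v h
  have : IsLocalHom (toInduced w v h) := IsLocalHom.of_surjective _ hsurj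
  have : IsSepClosed (ResidueField (inducedValuationSubring w v h)) := isSepClosed_residueField _
  have hbij : Function.Bijective (ResidueField.map (toInduced w v h)) := by
    refine ⟨RingHom.injective _, fun x => ?_⟩
    obtain ⟨y, rfl⟩ := residue_surjective x
    obtain ⟨z, rfl⟩ := hsurj y
    exact ⟨residue v z, rfl⟩
  exact IsSepClosed.of_ringEquiv (RingEquiv.ofBijective _ hbij).symm

/-- A henselian valuation whose residue field is neither separably closed nor henselian is the
canonical one. -/
theorem isCanonical_of_residueField {v : ValuationSubring K} (hv : HenselianLocalRing v)
    (hsep : ¬ IsSepClosed (ResidueField v)) (hhens : ¬ IsHenselianField (ResidueField v)) :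
    IsCanonical v := by
  refine Or.inr ⟨?_, ⟨hv, hsep⟩, fun w hw => le_of_henselian hw.1 hsep hhens⟩
  rintro ⟨w, hw, hwsep⟩
  exact hsep (isSepClosed_residueField_of_le (le_of_henselian hw hsep hhens))

/-! ### Restriction to relatively algebraically closed subfields -/

/-- If no monic polynomial without a root in `K` has a root in `L`, then `K` is relatively
algebraically closed in `L`: the minimal polynomial of an algebraic element is irreducible and has a
root in `K`, so it is linear. -/
theorem exists_eq_of_root {L : Type*} [Field L] (i : K →+* L)
    (hi : ∀ p : K[X], p.Monic → (∀ x, p.eval x ≠ 0) → ∀ y : L, p.eval₂ i y ≠ 0) {f : K[X]}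
    (hf : f ≠ 0) {y : L} (hy : f.eval₂ i y = 0) : ∃ x, i x = y := by
  let _ := i.toAlgebra
  have halg : IsIntegral K y := isAlgebraic_iff_isIntegral.1 ⟨f, hf, hy⟩
  by_contra! h
  have hirr := minpoly.irreducible halg
  refine hi (minpoly K y) (minpoly.monic halg) (fun x hx => h x ?_) y (minpoly.aeval K y)
  have hdeg := degree_eq_one_of_irreducible_of_root hirr hx
  rw [minpoly.degree_eq_one_iff] at hdeg
  obtain ⟨z, hz⟩ := hdeg
  have : minpoly K y = X - C z := by
    rw [← hz]; exact minpoly.eq_X_sub_C L z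
  rw [this] at hx
  rw [← hz]
  simp [sub_eq_zero] at hx
  rw [hx]; rfl

/-- The restriction of a henselian valuation to a relatively algebraically closed subfield is
henselian. -/
theorem henselianLocalRing_comap {L : Type*} [Field L] (i : K →+* L)
    (hi : ∀ p : K[X], p.Monic → (∀ x, p.eval x ≠ 0) → ∀ y : L, p.eval₂ i y ≠ 0)
    {w : ValuationSubring L} (hw : HenselianLocalRing w) : HenselianLocalRing (w.comap i) := by
  let j : w.comap i →+* w := (i.comp (w.comap i).subtype).codRestrict w.toSubring fun x => x.2
  have hj : IsLocalHom j := by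
    refine ⟨fun a ha => ?_⟩
    obtain ⟨b, hb⟩ := ha.exists_right_inv
    have hb' : i a * b = 1 := congrArg Subtype.val hb
    have hmem : (a : K)⁻¹ ∈ w.comap i := by
      rw [ValuationSubring.mem_comap, map_inv₀, ← eq_inv_of_mul_eq_one_right hb']
      exact b.2
    refine IsUnit.of_mul_eq_one ⟨_, hmem⟩ (Subtype.val_injective (mul_inv_cancel₀ ?_))
    intro h0
    rw [h0, map_zero, zero_mul] at hb'
    exact zero_ne_one hb'
  refine ⟨fun f hf a h₁ h₂ => ?_⟩
  obtain ⟨b, hb, hba⟩ := HenselianLocalRing.is_henselian (f.map j) (hf.map j) (j a)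
    (by
      rw [eval_map, eval₂_at_apply]
      exact fun h => h₁ (isUnit_of_map_unit j _ h))
    (by
      rw [derivative_map, eval_map, eval₂_at_apply]
      exact h₂.map j)
  have hb' : (f.map (w.comap i).subtype).eval₂ i (b : L) = 0 := by
    have := congrArg w.subtype hb.eq_zero
    rw [← eval₂_at_apply, eval₂_map, map_zero] at this
    rw [eval₂_map]
    exact this
  obtain ⟨x, hx⟩ := exists_eq_of_root i hi ((hf.map _).ne_zero) hb'
  have hxw : x ∈ w.comap i := by
    rw [ValuationSubring.mem_comap, hx]; exact b.2
  have hjx : j ⟨x, hxw⟩ = b := Subtype.val_injective hx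
  have hjinj : Function.Injective j := fun p q hpq =>
    Subtype.val_injective (i.injective (congrArg Subtype.val hpq))
  refine ⟨⟨x, hxw⟩, hjinj ?_, ?_⟩
  · rw [map_zero, ← eval₂_at_apply, hjx, ← eval_map]
    exact hb
  · rw [← hjx, ← map_sub] at hba
    exact fun h => hba (h.map j)

end CanonicalHenselian

namespace CanonicalHenselian

open FirstOrder FirstOrder.Language

/-! ### Predicates and functions defined by the same formula in two structures -/

section SameDef

variable {L : Language} {M : Type*} {N : Type*} {α β : Type}

/-- The functions `f` on `M` and `g` on `N` are given by the same term. -/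
def SameTerm (sM : L.Structure M) (sN : L.Structure N) (f : (α → M) → M) (g : (α → N) → N) : Prop :=
  ∃ t : L.Term α, (∀ x, t.realize x = f x) ∧ ∀ y, t.realize y = g y

/-- The predicates `P` on `M` and `Q` on `N` are defined by the same formula. -/
def SameDef (sM : L.Structure M) (sN : L.Structure N) (P : (α → M) → Prop) (Q : (α → N) → Prop) :
    Prop :=
  ∃ φ : L.Formula α, (∀ x, φ.Realize x ↔ P x) ∧ ∀ y, φ.Realize y ↔ Q y

variable {sM : L.Structure M} {sN : L.Structure N}

theorem SameTerm.var (i : α) : SameTerm sM sN (fun x => x i) (fun y => y i) :=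
  ⟨Term.var i, fun _ => rfl, fun _ => rfl⟩

theorem SameTerm.comp {f : (β → M) → M} {g : (β → N) → N} (h : SameTerm sM sN f g) (e : β → α) :
    SameTerm sM sN (fun x => f (x ∘ e)) (fun y => g (y ∘ e)) := by
  obtain ⟨t, hM, hN⟩ := h
  exact ⟨t.relabel e, fun x => by rw [Term.realize_relabel, hM],
    fun y => by rw [Term.realize_relabel, hN]⟩

theorem SameTerm.equal {f₁ f₂ : (α → M) → M} {g₁ g₂ : (α → N) → N} (h₁ : SameTerm sM sN f₁ g₁)
    (h₂ : SameTerm sM sN f₂ g₂) :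
    SameDef sM sN (fun x => f₁ x = f₂ x) (fun y => g₁ y = g₂ y) := by
  obtain ⟨t₁, hM₁, hN₁⟩ := h₁
  obtain ⟨t₂, hM₂, hN₂⟩ := h₂
  exact ⟨t₁.equal t₂, fun x => by rw [Formula.realize_equal, hM₁, hM₂],
    fun y => by rw [Formula.realize_equal, hN₁, hN₂]⟩

variable {P P' : (α → M) → Prop} {Q Q' : (α → N) → Prop}

theorem SameDef.congr (h : SameDef sM sN P Q) (hP : ∀ x, P x ↔ P' x) (hQ : ∀ y, Q y ↔ Q' y) :
    SameDef sM sN P' Q' := by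
  obtain ⟨φ, hM, hN⟩ := h
  exact ⟨φ, fun x => (hM x).trans (hP x), fun y => (hN y).trans (hQ y)⟩

theorem SameDef.false : SameDef sM sN (fun _ : α → M => False) (fun _ => False) :=
  ⟨⊥, fun _ => Iff.rfl, fun _ => Iff.rfl⟩

theorem SameDef.imp (h : SameDef sM sN P Q) (h' : SameDef sM sN P' Q') :
    SameDef sM sN (fun x => P x → P' x) (fun y => Q y → Q' y) := by
  obtain ⟨φ, hM, hN⟩ := h
  obtain ⟨ψ, hM', hN'⟩ := h'
  exact ⟨φ.imp ψ, fun x => by rw [Formula.realize_imp, hM, hM'],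
    fun y => by rw [Formula.realize_imp, hN, hN']⟩

theorem SameDef.not (h : SameDef sM sN P Q) : SameDef sM sN (fun x => ¬ P x) (fun y => ¬ Q y) :=
  h.imp SameDef.false

theorem SameDef.and (h : SameDef sM sN P Q) (h' : SameDef sM sN P' Q') :
    SameDef sM sN (fun x => P x ∧ P' x) (fun y => Q y ∧ Q' y) :=
  (h.imp h'.not).not.congr (fun _ => by tauto) fun _ => by tauto

theorem SameDef.or (h : SameDef sM sN P Q) (h' : SameDef sM sN P' Q') :
    SameDef sM sN (fun x => P x ∨ P' x) (fun y => Q y ∨ Q' y) :=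
  (h.not.imp h').congr (fun _ => by tauto) fun _ => by tauto

theorem SameDef.finite_all {ι : Type*} [Finite ι] {P : ι → (α → M) → Prop}
    {Q : ι → (α → N) → Prop} (h : ∀ i, SameDef sM sN (P i) (Q i)) :
    SameDef sM sN (fun x => ∀ i, P i x) (fun y => ∀ i, Q i y) := by
  choose φ hM hN using h
  exact ⟨Formula.iInf φ, fun x => by simp [Formula.realize_iInf, hM],
    fun y => by simp [Formula.realize_iInf, hN]⟩

theorem SameDef.all_tuple [Finite β] {P : (α → M) → (β → M) → Prop} {Q : (α → N) → (β → N) → Prop}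
    (h : SameDef sM sN (fun z : α ⊕ β → M => P (z ∘ Sum.inl) (z ∘ Sum.inr))
      (fun z => Q (z ∘ Sum.inl) (z ∘ Sum.inr))) :
    SameDef sM sN (fun x => ∀ a, P x a) (fun y => ∀ b, Q y b) := by
  obtain ⟨φ, hM, hN⟩ := h
  exact ⟨φ.iAlls β, fun x => by rw [Formula.realize_iAlls]; exact forall_congr' fun a => hM _,
    fun y => by rw [Formula.realize_iAlls]; exact forall_congr' fun b => hN _⟩

theorem SameDef.all {P : (α → M) → M → Prop} {Q : (α → N) → N → Prop}
    (h : SameDef sM sN (fun z : α ⊕ Unit → M => P (z ∘ Sum.inl) (z (Sum.inr ())))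
      (fun z => Q (z ∘ Sum.inl) (z (Sum.inr ())))) :
    SameDef sM sN (fun x => ∀ a, P x a) (fun y => ∀ b, Q y b) :=
  (SameDef.all_tuple (β := Unit) (P := fun x a => P x (a ())) (Q := fun y b => Q y (b ())) h).congr
    (fun _ => ⟨fun h a => h fun _ => a, fun h a => h (a ())⟩)
    fun _ => ⟨fun h a => h fun _ => a, fun h a => h (a ())⟩

theorem SameDef.ex {P : (α → M) → M → Prop} {Q : (α → N) → N → Prop}
    (h : SameDef sM sN (fun z : α ⊕ Unit → M => P (z ∘ Sum.inl) (z (Sum.inr ())))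
      (fun z => Q (z ∘ Sum.inl) (z (Sum.inr ())))) :
    SameDef sM sN (fun x => ∃ a, P x a) (fun y => ∃ b, Q y b) :=
  (SameDef.all (P := fun x a => ¬ P x a) (Q := fun y b => ¬ Q y b) h.not).not.congr
    (fun _ => by simp) fun _ => by simp

theorem SameDef.subst {P : (β → M) → Prop} {Q : (β → N) → Prop} (h : SameDef sM sN P Q)
    {f : β → (α → M) → M} {g : β → (α → N) → N} (hfg : ∀ i, SameTerm sM sN (f i) (g i)) :
    SameDef sM sN (fun x => P fun i => f i x) (fun y => Q fun i => g i y) := by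
  obtain ⟨φ, hM, hN⟩ := h
  choose t htM htN using hfg
  refine ⟨BoundedFormula.subst φ t, fun x => ?_, fun y => ?_⟩
  · rw [Formula.Realize, BoundedFormula.realize_subst]
    simp only [htM]
    exact hM _
  · rw [Formula.Realize, BoundedFormula.realize_subst]
    simp only [htN]
    exact hN _

/-- Elementarily equivalent structures agree about the sentences that hold in them. -/
theorem SameDef.iff_of_elementarilyEquivalent {p q : Prop}
    (h : SameDef (α := Empty) sM sN (fun _ => p) (fun _ => q)) (hMN : M ≅[L] N) : p ↔ q := by
  obtain ⟨φ, hM, hN⟩ := h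
  exact (hM default).symm.trans ((elementarilyEquivalent_iff.1 hMN φ).trans (hN default))

/-- The map that regards the last bound variable of a formula as a variable of its own. -/
def lastVar (n : ℕ) : Empty ⊕ Fin (n + 1) → (Empty ⊕ Fin n) ⊕ Unit :=
  Sum.elim (fun a => Sum.inl (Sum.inl a))
    (Fin.snoc (α := fun _ => (Empty ⊕ Fin n) ⊕ Unit) (fun i => Sum.inl (Sum.inr i)) (Sum.inr ()))

theorem elim_comp_inl_inr {A B : Type*} {n : ℕ} (q : A → B) (x : Empty ⊕ Fin n → A) :
    Sum.elim (q ∘ x ∘ Sum.inl) (q ∘ x ∘ Sum.inr) = q ∘ x := by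
  ext (i | i) <;> rfl

/-- The step of a universal quantifier in the translation of formulas along an interpretation: a
quantifier over `M'` becomes a quantifier over the domain `D` of the map `r`. -/
theorem realize_all_iff_of_pullback {L' : Language} {M' : Type*} [L'.Structure M'] {D : M → Prop}
    {r : M → M'} (hr : ∀ m', ∃ m, D m ∧ r m = m') {n : ℕ} {φ : L'.BoundedFormula Empty (n + 1)}
    {P : (Empty ⊕ Fin (n + 1) → M) → Prop}
    (hP : ∀ x, (∀ i, D (x i)) → (P x ↔ φ.Realize (r ∘ x ∘ Sum.inl) (r ∘ x ∘ Sum.inr)))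
    (x : Empty ⊕ Fin n → M) (hx : ∀ i, D (x i)) :
    (∀ a, D a → P ((Sum.elim x fun _ => a) ∘ lastVar n)) ↔
      φ.all.Realize (r ∘ x ∘ Sum.inl) (r ∘ x ∘ Sum.inr) := by
  have hstep : ∀ a, D a → (P ((Sum.elim x fun _ => a) ∘ lastVar n) ↔
      φ.Realize (r ∘ x ∘ Sum.inl)
        (Fin.snoc (α := fun _ => M') (r ∘ x ∘ Sum.inr) (r a))) := by
    intro a ha
    have hD : ∀ j : (Empty ⊕ Fin n) ⊕ Unit, D ((Sum.elim x fun _ => a) j) := by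
      rintro (j | j)
      · exact hx j
      · exact ha
    have he : r ∘ ((Sum.elim x fun _ => a) ∘ lastVar n) ∘ Sum.inr =
        Fin.snoc (α := fun _ => M') (r ∘ x ∘ Sum.inr) (r a) := by
      ext i
      refine Fin.lastCases ?_ (fun i => ?_) i <;> simp [lastVar]
    rw [hP ((Sum.elim x fun _ => a) ∘ lastVar n) fun i => hD _, he]
    rfl
  rw [BoundedFormula.realize_all]
  constructor
  · intro H m'
    obtain ⟨m, hm, rfl⟩ := hr m'
    exact (hstep m hm).1 (H m hm)
  · exact fun H m hm => (hstep m hm).2 (H (r m))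

theorem SameDef.comp {P : (β → M) → Prop} {Q : (β → N) → Prop} (h : SameDef sM sN P Q)
    (e : β → α) : SameDef sM sN (fun x => P (x ∘ e)) (fun y => Q (y ∘ e)) :=
  h.subst fun i => SameTerm.var (e i)

/-- Elementary equivalence is inherited by structures that are interpreted in the same way: the
elements of `M'` are represented by elements of the definable subset `DM` of `M`, and equality and
the symbols of `L'` are pulled back to predicates and functions that are definable in `M`,
and `N'` is interpreted in `N` by the same formulas. -/
theorem elementarilyEquivalent_of_interpretation {L' : Language} {M' N' : Type*}
    [L'.Structure M'] [L'.Structure N'] (DM : M → Prop) (DN : N → Prop) (r : M → M') (s : N → N')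
    (hr : ∀ m', ∃ m, DM m ∧ r m = m') (hs : ∀ n', ∃ n, DN n ∧ s n = n')
    (hD : SameDef sM sN (fun z : Unit → M => DM (z ())) (fun z => DN (z ())))
    (hterm : ∀ {α : Type} (t : L'.Term α), ∃ f g, SameTerm sM sN f g ∧
      (∀ x, (∀ i, DM (x i)) → DM (f x) ∧ r (f x) = t.realize (r ∘ x)) ∧
      ∀ y, (∀ i, DN (y i)) → DN (g y) ∧ s (g y) = t.realize (s ∘ y))
    (heq : ∃ P Q, SameDef (α := Fin 2) sM sN P Q ∧
      (∀ x, (∀ i, DM (x i)) → (P x ↔ r (x 0) = r (x 1))) ∧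
      ∀ y, (∀ i, DN (y i)) → (Q y ↔ s (y 0) = s (y 1)))
    (hrel : ∀ {k : ℕ} (R : L'.Relations k), ∃ P Q, SameDef (α := Fin k) sM sN P Q ∧
      (∀ x, (∀ i, DM (x i)) → (P x ↔ Structure.RelMap R (r ∘ x))) ∧
      ∀ y, (∀ i, DN (y i)) → (Q y ↔ Structure.RelMap R (s ∘ y)))
    (hMN : M ≅[L] N) : M' ≅[L'] N' := by
  have key : ∀ {n : ℕ} (φ : L'.BoundedFormula Empty n), ∃ P Q,
      SameDef (α := Empty ⊕ Fin n) sM sN P Q ∧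
      (∀ x, (∀ i, DM (x i)) → (P x ↔ φ.Realize (r ∘ x ∘ Sum.inl) (r ∘ x ∘ Sum.inr))) ∧
      ∀ y, (∀ i, DN (y i)) → (Q y ↔ φ.Realize (s ∘ y ∘ Sum.inl) (s ∘ y ∘ Sum.inr)) := by
    intro n φ
    induction φ with
    | falsum => exact ⟨_, _, SameDef.false, fun _ _ => Iff.rfl, fun _ _ => Iff.rfl⟩
    | equal t₁ t₂ =>
      obtain ⟨P, Q, hPQ, hP, hQ⟩ := heq
      obtain ⟨f₁, g₁, h₁, hf₁, hg₁⟩ := hterm t₁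
      obtain ⟨f₂, g₂, h₂, hf₂, hg₂⟩ := hterm t₂
      refine ⟨_, _, hPQ.subst (f := ![f₁, f₂]) (g := ![g₁, g₂]) (Fin.forall_fin_two.2 ⟨h₁, h₂⟩),
        fun x hx => ?_, fun y hy => ?_⟩
      · rw [hP _ (Fin.forall_fin_two.2 ⟨(hf₁ x hx).1, (hf₂ x hx).1⟩)]
        rw [BoundedFormula.Realize, elim_comp_inl_inr, ← (hf₁ x hx).2, ← (hf₂ x hx).2]
        rfl
      · rw [hQ _ (Fin.forall_fin_two.2 ⟨(hg₁ y hy).1, (hg₂ y hy).1⟩)]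
        rw [BoundedFormula.Realize, elim_comp_inl_inr, ← (hg₁ y hy).2, ← (hg₂ y hy).2]
        rfl
    | rel R ts =>
      obtain ⟨P, Q, hPQ, hP, hQ⟩ := hrel R
      choose f g h hf hg using fun i => hterm (ts i)
      refine ⟨_, _, hPQ.subst h, fun x hx => ?_, fun y hy => ?_⟩
      · rw [hP _ fun i => (hf i x hx).1]
        rw [BoundedFormula.Realize, elim_comp_inl_inr]
        simp only [← (hf _ x hx).2]
        rfl
      · rw [hQ _ fun i => (hg i y hy).1]
        rw [BoundedFormula.Realize, elim_comp_inl_inr]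
        simp only [← (hg _ y hy).2]
        rfl
    | imp φ₁ φ₂ ih₁ ih₂ =>
      obtain ⟨P₁, Q₁, h₁, hP₁, hQ₁⟩ := ih₁
      obtain ⟨P₂, Q₂, h₂, hP₂, hQ₂⟩ := ih₂
      exact ⟨_, _, h₁.imp h₂, fun x hx => imp_congr (hP₁ x hx) (hP₂ x hx),
        fun y hy => imp_congr (hQ₁ y hy) (hQ₂ y hy)⟩
    | @all n φ ih =>
      obtain ⟨P, Q, h, hP, hQ⟩ := ih
      refine ⟨fun x => ∀ a, DM a → P ((Sum.elim x fun _ => a) ∘ lastVar n),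
        fun y => ∀ b, DN b → Q ((Sum.elim y fun _ => b) ∘ lastVar n),
        SameDef.all ((hD.comp fun _ => Sum.inr ()).imp ((h.comp (lastVar n)).congr ?_ ?_)),
        realize_all_iff_of_pullback hr hP, realize_all_iff_of_pullback hs hQ⟩
      all_goals
        intro z
        rw [show (Sum.elim (z ∘ Sum.inl) fun _ => z (Sum.inr ())) = z by ext (i | i) <;> rfl]
  rw [elementarilyEquivalent_iff]
  intro φ
  obtain ⟨P, Q, h, hP, hQ⟩ := key (n := 0) φ
  have h₀ : Empty ⊕ Fin 0 → False := by rintro (i | i); exacts [i.elim, i.elim0]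
  have := SameDef.iff_of_elementarilyEquivalent (p := P fun i => (h₀ i).elim)
    (q := Q fun i => (h₀ i).elim) ?_ hMN
  · rw [hP _ fun i => (h₀ i).elim, hQ _ fun i => (h₀ i).elim] at this
    convert this using 1
    · unfold Sentence.Realize Formula.Realize
      rw [Subsingleton.elim (default : Empty → M') _, Subsingleton.elim (default : Fin 0 → M') _]
    · unfold Sentence.Realize Formula.Realize
      rw [Subsingleton.elim (default : Empty → N') _, Subsingleton.elim (default : Fin 0 → N') _]
  · refine (h.comp (α := Empty) fun i => (h₀ i).elim).congr (fun x => ?_) fun y => ?_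
    · exact iff_of_eq (congrArg P (funext fun i => (h₀ i).elim))
    · exact iff_of_eq (congrArg Q (funext fun i => (h₀ i).elim))

end SameDef

end CanonicalHenselian

namespace CanonicalHenselian

open FirstOrder FirstOrder.Language Polynomial

variable {K L : Type*} [Field K] [Field L] {α β : Type}

/-! ### Fields and valued fields as first-order structures -/

/-- A field as a structure for the language of rings. -/
abbrev ringStructure (K : Type*) [Field K] : Language.ring.Structure K :=
  (Ring.compatibleRingOfRing K).toStructure

/-- A field with a distinguished subset as a structure for the language of valued fields. -/
abbrev setStructure {K : Type*} [Field K] (S : Set K) : valuedLang.Structure K :=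
  letI := Ring.compatibleRingOfRing K
  letI := predStructure S
  Language.sumStructure Language.ring predLang K

section Terms

local notation "Tm" => SameTerm (ringStructure K) (ringStructure L)

variable {f f' : (α → K) → K} {g g' : (α → L) → L}

theorem SameTerm.add (h : Tm f g) (h' : Tm f' g') :
    Tm (fun x => f x + f' x) (fun y => g y + g' y) := by
  obtain ⟨t, hK, hL⟩ := h
  obtain ⟨t', hK', hL'⟩ := h'
  let _ := Ring.compatibleRingOfRing K
  let _ := Ring.compatibleRingOfRing L
  exact ⟨t + t', fun x => (Ring.realize_add _ _ _).trans (by rw [hK, hK']),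
    fun y => (Ring.realize_add _ _ _).trans (by rw [hL, hL'])⟩

theorem SameTerm.mul (h : Tm f g) (h' : Tm f' g') :
    Tm (fun x => f x * f' x) (fun y => g y * g' y) := by
  obtain ⟨t, hK, hL⟩ := h
  obtain ⟨t', hK', hL'⟩ := h'
  let _ := Ring.compatibleRingOfRing K
  let _ := Ring.compatibleRingOfRing L
  exact ⟨t * t', fun x => (Ring.realize_mul _ _ _).trans (by rw [hK, hK']),
    fun y => (Ring.realize_mul _ _ _).trans (by rw [hL, hL'])⟩

theorem SameTerm.neg (h : Tm f g) : Tm (fun x => - f x) (fun y => - g y) := by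
  obtain ⟨t, hK, hL⟩ := h
  let _ := Ring.compatibleRingOfRing K
  let _ := Ring.compatibleRingOfRing L
  exact ⟨-t, fun x => (Ring.realize_neg _ _).trans (by rw [hK]),
    fun y => (Ring.realize_neg _ _).trans (by rw [hL])⟩

theorem SameTerm.zero : Tm (fun _ : α → K => 0) (fun _ => 0) := by
  let _ := Ring.compatibleRingOfRing K
  let _ := Ring.compatibleRingOfRing L
  exact ⟨0, fun _ => Ring.realize_zero _, fun _ => Ring.realize_zero _⟩

theorem SameTerm.one : Tm (fun _ : α → K => 1) (fun _ => 1) := by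
  let _ := Ring.compatibleRingOfRing K
  let _ := Ring.compatibleRingOfRing L
  exact ⟨1, fun _ => Ring.realize_one _, fun _ => Ring.realize_one _⟩

theorem SameTerm.sub (h : Tm f g) (h' : Tm f' g') :
    Tm (fun x => f x - f' x) (fun y => g y - g' y) := by
  simp only [sub_eq_add_neg]
  exact h.add h'.neg

theorem SameTerm.natCast (n : ℕ) : Tm (fun _ : α → K => n) (fun _ => n) := by
  induction n with
  | zero => simpa using SameTerm.zero
  | succ n ih => simpa using ih.add SameTerm.one

theorem SameTerm.pow (h : Tm f g) (n : ℕ) : Tm (fun x => f x ^ n) (fun y => g y ^ n) := by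
  induction n with
  | zero => simpa using SameTerm.one
  | succ n ih => simpa only [pow_succ] using ih.mul h

theorem SameTerm.sum {ι : Type*} (s : Finset ι) {f : ι → (α → K) → K} {g : ι → (α → L) → L}
    (h : ∀ i, Tm (f i) (g i)) : Tm (fun x => ∑ i ∈ s, f i x) (fun y => ∑ i ∈ s, g i y) := by
  classical
  induction s using Finset.induction_on with
  | empty => simpa using SameTerm.zero
  | insert i s hi ih => simpa only [Finset.sum_insert hi] using (h i).add ih

/-- The coefficients of the polynomials `F x` over `K` and `G y` over `L` are given by the same
terms in `x` and in `y`. -/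
def SamePoly (F : (α → K) → K[X]) (G : (α → L) → L[X]) : Prop :=
  ∀ i, Tm (fun x => (F x).coeff i) (fun y => (G y).coeff i)

variable {F F' : (α → K) → K[X]} {G G' : (α → L) → L[X]}

theorem SamePoly.add (h : SamePoly F G) (h' : SamePoly F' G') :
    SamePoly (fun x => F x + F' x) (fun y => G y + G' y) := fun i => by
  simpa only [coeff_add] using (h i).add (h' i)

theorem SamePoly.mul (h : SamePoly F G) (h' : SamePoly F' G') :
    SamePoly (fun x => F x * F' x) (fun y => G y * G' y) := fun i => by
  simpa only [coeff_mul] using SameTerm.sum _ fun p : ℕ × ℕ => (h p.1).mul (h' p.2)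

theorem SamePoly.C (h : Tm f g) : SamePoly (fun x => C (f x)) (fun y => C (g y)) := fun i => by
  simp only [coeff_C]
  split_ifs
  exacts [h, SameTerm.zero]

theorem SamePoly.X_pow (n : ℕ) :
    SamePoly (fun _ : α → K => X ^ n) (fun _ : α → L => X ^ n) := fun i => by
  simp only [coeff_X_pow]
  split_ifs
  exacts [SameTerm.one, SameTerm.zero]

theorem SamePoly.sum {ι : Type*} (s : Finset ι) {F : ι → (α → K) → K[X]} {G : ι → (α → L) → L[X]}
    (h : ∀ i, SamePoly (F i) (G i)) :
    SamePoly (fun x => ∑ i ∈ s, F i x) (fun y => ∑ i ∈ s, G i y) := fun i => by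
  simpa only [finsetSum_coeff] using SameTerm.sum s fun j => h j i

theorem SamePoly.derivative (h : SamePoly F G) :
    SamePoly (fun x => derivative (F x)) (fun y => derivative (G y)) := fun i => by
  simpa only [coeff_derivative, Nat.cast_add, Nat.cast_one] using
    (h (i + 1)).mul ((SameTerm.natCast i).add SameTerm.one)

theorem SamePoly.monicOf {n : ℕ} {f : Fin n → (α → K) → K} {g : Fin n → (α → L) → L}
    (h : ∀ i, Tm (f i) (g i)) :
    SamePoly (fun x => monicOf fun i => f i x) (fun y => monicOf fun i => g i y) :=
  (SamePoly.X_pow n).add (SamePoly.sum _ fun i => (SamePoly.C (h i)).mul (SamePoly.X_pow i))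

theorem SamePoly.eval (h : SamePoly F G) (hfg : Tm f g) {n : ℕ} (hF : ∀ x, (F x).natDegree < n)
    (hG : ∀ y, (G y).natDegree < n) :
    Tm (fun x => (F x).eval (f x)) (fun y => (G y).eval (g y)) := by
  simp only [eval_eq_sum_range' (hF _), eval_eq_sum_range' (hG _)]
  exact SameTerm.sum _ fun i => (h i).mul (hfg.pow i)

theorem SamePoly.eval_monicOf {n : ℕ} {a : Fin n → (α → K) → K} {b : Fin n → (α → L) → L}
    (h : ∀ i, Tm (a i) (b i)) (hfg : Tm f g) :
    Tm (fun x => (CanonicalHenselian.monicOf fun i => a i x).eval (f x))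
      (fun y => (CanonicalHenselian.monicOf fun i => b i y).eval (g y)) :=
  (SamePoly.monicOf h).eval hfg (n := n + 1) (fun _ => by rw [natDegree_monicOf]; exact n.lt_succ_self)
    fun _ => by rw [natDegree_monicOf]; exact n.lt_succ_self

theorem SamePoly.eval_derivative_monicOf {n : ℕ} {a : Fin n → (α → K) → K}
    {b : Fin n → (α → L) → L} (h : ∀ i, Tm (a i) (b i)) (hfg : Tm f g) :
    Tm (fun x => (Polynomial.derivative (CanonicalHenselian.monicOf fun i => a i x)).eval (f x))
      (fun y => (Polynomial.derivative (CanonicalHenselian.monicOf fun i => b i y)).eval (g y)) := by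
  refine (SamePoly.monicOf h).derivative.eval hfg (n := n + 1) (fun _ => ?_) fun _ => ?_
  all_goals
    refine (natDegree_derivative_le _).trans_lt ?_
    rw [natDegree_monicOf]
    exact (Nat.sub_le _ _).trans_lt n.lt_succ_self

/-- A field is separably closed if it satisfies, for all `n` and `m`, the axiom that a monic
polynomial `f` of degree `n + 1` has a root if there are polynomials `p` and `q` of degree less than
`m` such that `p * f + q * f' = 1`. -/
theorem isSepClosed_iff (K : Type*) [Field K] : IsSepClosed K ↔ ∀ n m : ℕ,
    ∀ (a : Fin (n + 1) → K) (b c : Fin m → K),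
      (∀ i : Fin (n + 2 + m), ((∑ j, C (b j) * X ^ (j : ℕ)) * monicOf a +
        (∑ j, C (c j) * X ^ (j : ℕ)) * derivative (monicOf a)).coeff i = (1 : K[X]).coeff i) →
      ∃ x, (monicOf a).eval x = 0 := by
  constructor
  · intro hK n m a b c h
    have hdeg := natDegree_monicOf a
    refine IsSepClosed.exists_root (monicOf a) (fun h0 => ?_)
      ⟨∑ j, C (b j) * X ^ (j : ℕ), ∑ j, C (c j) * X ^ (j : ℕ), ?_⟩
    · rw [natDegree_eq_of_degree_eq_some h0] at hdeg
      exact absurd hdeg (Nat.succ_ne_zero n).symm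
    · have hsum : ∀ d : Fin m → K, (∑ j, C (d j) * X ^ (j : ℕ)).natDegree ≤ m := fun d =>
        natDegree_sum_le_of_forall_le _ _ fun j _ =>
          (natDegree_C_mul_X_pow_le _ _).trans j.2.le
      have hbound : ((∑ j, C (b j) * X ^ (j : ℕ)) * monicOf a +
          (∑ j, C (c j) * X ^ (j : ℕ)) * derivative (monicOf a)).natDegree < n + 2 + m := by
        have h₁ := natDegree_mul_le_of_le (hsum b) hdeg.le
        have h₂ := natDegree_mul_le_of_le (hsum c) ((natDegree_derivative_le (monicOf a)).trans
          (Nat.sub_le_sub_right hdeg.le 1))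
        have h₃ := natDegree_add_le_of_degree_le h₁ (h₂.trans (by omega))
        omega
      ext i
      by_cases hi : i < n + 2 + m
      · exact h ⟨i, hi⟩
      · rw [coeff_eq_zero_of_natDegree_lt (by omega), coeff_one, if_neg (by omega)]
  · intro h
    refine IsSepClosed.of_exists_root _ fun p hp hirr hsep => ?_
    obtain ⟨n, hn⟩ := Nat.exists_eq_succ_of_ne_zero hirr.natDegree_pos.ne'
    obtain ⟨u, v, huv⟩ := hsep
    have hsum : ∀ q : K[X], ∀ m, q.natDegree < m → ∑ j : Fin m, C (q.coeff j) * X ^ (j : ℕ) = q :=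
      fun q m hm => by
        rw [Fin.sum_univ_eq_sum_range fun i => C (q.coeff i) * X ^ i]
        exact (as_sum_range_C_mul_X_pow' q hm).symm
    obtain ⟨x, hx⟩ := h n (max u.natDegree v.natDegree + 1) (fun i => p.coeff i)
      (fun i => u.coeff i) (fun i => v.coeff i) (fun i => by
        rw [hsum u _ (by omega), hsum v _ (by omega), ← eq_monicOf hp hn, huv])
    exact ⟨x, by rwa [← eq_monicOf hp hn] at hx⟩

theorem FieldEquiv.isSepClosed_iff (h : FieldEquiv K L) : IsSepClosed K ↔ IsSepClosed L := by
  rw [CanonicalHenselian.isSepClosed_iff K, CanonicalHenselian.isSepClosed_iff L]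
  refine forall_congr' fun n => forall_congr' fun m =>
    SameDef.iff_of_elementarilyEquivalent (sM := ringStructure K) (sN := ringStructure L) ?_ h
  refine SameDef.all_tuple (SameDef.all_tuple (SameDef.all_tuple (SameDef.imp
    (SameDef.finite_all fun i => SameTerm.equal ?_ ?_) (SameDef.ex (SameTerm.equal ?_ ?_)))))
  · refine SamePoly.add (SamePoly.mul (SamePoly.sum _ fun j => (SamePoly.C ?_).mul
      (SamePoly.X_pow _)) (SamePoly.monicOf fun j => ?_)) (SamePoly.mul (SamePoly.sum _ fun j =>
      (SamePoly.C ?_).mul (SamePoly.X_pow _)) (SamePoly.monicOf fun j => ?_).derivative) _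
    all_goals exact SameTerm.var _
  · simpa only [coeff_one] using by split_ifs; exacts [SameTerm.one, SameTerm.zero]
  · exact SamePoly.eval_monicOf (fun j => SameTerm.var _) (SameTerm.var _)
  · exact SameTerm.zero

end Terms

end CanonicalHenselian

namespace CanonicalHenselian

open FirstOrder FirstOrder.Language Polynomial IsLocalRing

variable {K L : Type*} [Field K] [Field L] {α β : Type}

section Valued

variable (S : Set K) (T : Set L)

/-- A formula of the language of rings has the same meaning in a field with a distinguished
subset. -/
theorem realize_onFormula_sumInl (φ : Language.ring.Formula α) (x : α → K) :
    @Formula.Realize _ _ (setStructure S) _ (LHom.sumInl.onFormula φ) x ↔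
      @Formula.Realize _ _ (ringStructure K) _ φ x := by
  let _ := ringStructure K
  let _ := predStructure S
  exact LHom.realize_onFormula _ φ

theorem SameTerm.lift {f : (α → K) → K} {g : (α → L) → L}
    (h : SameTerm (ringStructure K) (ringStructure L) f g) :
    SameTerm (setStructure S) (setStructure T) f g := by
  obtain ⟨t, hK, hL⟩ := h
  refine ⟨LHom.sumInl.onTerm t, fun x => ?_, fun y => ?_⟩
  · let _ := ringStructure K
    let _ := predStructure S
    exact (LHom.realize_onTerm _ t x).trans (hK x)
  · let _ := ringStructure L
    let _ := predStructure T
    exact (LHom.realize_onTerm _ t y).trans (hL y)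

variable {S T}

theorem SameTerm.mem {f : (α → K) → K} {g : (α → L) → L}
    (h : SameTerm (ringStructure K) (ringStructure L) f g) :
    SameDef (setStructure S) (setStructure T) (fun x => f x ∈ S) (fun y => g y ∈ T) := by
  obtain ⟨t, hK, hL⟩ := h.lift S T
  let _ := setStructure S
  let _ := setStructure T
  exact ⟨Relations.formula₁ (Sum.inr PredRel.mem : valuedLang.Relations 1) t,
    fun x => Formula.realize_rel₁.trans (iff_of_eq (congrArg (· ∈ S) (hK x))),
    fun y => Formula.realize_rel₁.trans (iff_of_eq (congrArg (· ∈ T) (hL y)))⟩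

/-- If `S` is the valuation ring of a valuation, then `IsSmall S z` says that `z` belongs to the
maximal ideal. -/
def IsSmall (S : Set K) (z : K) : Prop := z ∈ S ∧ ∀ t, t ∈ S → z * t ≠ 1

theorem SameTerm.isSmall {f : (α → K) → K} {g : (α → L) → L}
    (h : SameTerm (ringStructure K) (ringStructure L) f g) :
    SameDef (setStructure S) (setStructure T) (fun x => IsSmall S (f x))
      (fun y => IsSmall T (g y)) := by
  exact h.mem.and (SameDef.all ((SameTerm.var _).mem.imp
    (SameTerm.equal (SameTerm.lift S T (SameTerm.mul (h.comp Sum.inl) (SameTerm.var _)))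
      (SameTerm.one.lift S T)).not))

theorem isSmall_iff {v : ValuationSubring K} (z : v) :
    IsSmall (v : Set K) (z : K) ↔ z ∈ maximalIdeal v := by
  rw [mem_maximalIdeal, mem_nonunits_iff, isUnit_iff_exists_inv]
  refine ⟨?_, fun h => ⟨z.2, fun t ht hzt => h ⟨⟨t, ht⟩, Subtype.val_injective hzt⟩⟩⟩
  rintro ⟨-, h⟩ ⟨t, ht⟩
  exact h t t.2 (congrArg Subtype.val ht)

theorem exists_valuationSubring_of_elementarilyEquivalent (v : ValuationSubring K)
    (h : @ElementarilyEquivalent valuedLang K L (setStructure (v : Set K)) (setStructure T)) :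
    ∃ w : ValuationSubring L, (w : Set L) = T := by
  have hadd : ∀ a b, a ∈ T → b ∈ T → a + b ∈ T := by
    refine (SameDef.iff_of_elementarilyEquivalent
      (p := ∀ a b, a ∈ (v : Set K) → b ∈ (v : Set K) → a + b ∈ (v : Set K)) ?_ h).1 v.add_mem
    refine SameDef.all (SameDef.all (SameDef.imp ?_ (SameDef.imp ?_ ?_)))
    exacts [(SameTerm.var _).mem, (SameTerm.var _).mem,
      ((SameTerm.var (Sum.inl (Sum.inr ()))).add (SameTerm.var _)).mem]
  have hmul : ∀ a b, a ∈ T → b ∈ T → a * b ∈ T := by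
    refine (SameDef.iff_of_elementarilyEquivalent
      (p := ∀ a b, a ∈ (v : Set K) → b ∈ (v : Set K) → a * b ∈ (v : Set K)) ?_ h).1 v.mul_mem
    refine SameDef.all (SameDef.all (SameDef.imp ?_ (SameDef.imp ?_ ?_)))
    exacts [(SameTerm.var _).mem, (SameTerm.var _).mem,
      ((SameTerm.var (Sum.inl (Sum.inr ()))).mul (SameTerm.var _)).mem]
  have hneg : ∀ a, a ∈ T → -a ∈ T := by
    refine (SameDef.iff_of_elementarilyEquivalent
      (p := ∀ a, a ∈ (v : Set K) → -a ∈ (v : Set K)) ?_ h).1 v.neg_mem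
    exact SameDef.all ((SameTerm.var _).mem.imp (SameTerm.var _).neg.mem)
  have hzero : 0 ∈ T := (SameDef.iff_of_elementarilyEquivalent
    (p := 0 ∈ (v : Set K)) SameTerm.zero.mem h).1 v.zero_mem
  have hone : 1 ∈ T := (SameDef.iff_of_elementarilyEquivalent
    (p := 1 ∈ (v : Set K)) SameTerm.one.mem h).1 v.one_mem
  have hinv : ∀ a b : L, a * b = 1 → a ∈ T ∨ b ∈ T := by
    refine (SameDef.iff_of_elementarilyEquivalent
      (p := ∀ a b : K, a * b = 1 → a ∈ (v : Set K) ∨ b ∈ (v : Set K)) ?_ h).1 ?_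
    · refine SameDef.all (SameDef.all (SameDef.imp (SameTerm.equal
        (SameTerm.lift _ _ (SameTerm.mul (SameTerm.var _) (SameTerm.var _)))
        (SameTerm.one.lift _ _)) (SameDef.or (SameTerm.var _).mem (SameTerm.var _).mem)))
    · intro a b hab
      rw [eq_inv_of_mul_eq_one_right hab]
      exact v.mem_or_inv_mem a
  refine ⟨{ carrier := T
            add_mem' := hadd _ _
            mul_mem' := hmul _ _
            neg_mem' := hneg _
            zero_mem' := hzero
            one_mem' := hone
            mem_or_inv_mem' := fun x => ?_ }, rfl⟩
  rcases eq_or_ne x 0 with rfl | hx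
  · exact Or.inl hzero
  · exact hinv x x⁻¹ (mul_inv_cancel₀ hx)

/-- Hensel's lemma for a valuation ring as a scheme of axioms, one for every degree. -/
theorem henselianLocalRing_iff (v : ValuationSubring K) : HenselianLocalRing v ↔
    ∀ n : ℕ, ∀ (a : Fin n → K) (x : K), (∀ i, a i ∈ (v : Set K)) → x ∈ (v : Set K) →
      IsSmall (v : Set K) ((monicOf a).eval x) →
      ¬ IsSmall (v : Set K) ((derivative (monicOf a)).eval x) →
      ∃ y, y ∈ (v : Set K) ∧ (monicOf a).eval y = 0 ∧ IsSmall (v : Set K) (y - x) := by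
  have hder : ∀ {n : ℕ} (a : Fin n → v) (x : v),
      (derivative (monicOf fun i => (a i : K))).eval (x : K) =
        (derivative (monicOf a)).eval x := by
    intro n a x
    change (derivative (monicOf fun i => v.subtype (a i))).eval (v.subtype x) = v.subtype _
    rw [← map_monicOf, derivative_map, eval_map, eval₂_at_apply]
  have heval : ∀ {n : ℕ} (a : Fin n → v) (x : v),
      (monicOf fun i => (a i : K)).eval (x : K) = (monicOf a).eval x :=
    fun a x => eval_monicOf_map v.subtype a x
  constructor
  · intro hv n a x ha hx h₁ h₂
    lift a to Fin n → v using ha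
    lift x to v using hx
    rw [heval, isSmall_iff] at h₁
    rw [hder, isSmall_iff, mem_maximalIdeal, mem_nonunits_iff, not_not] at h₂
    obtain ⟨y, hy, hyx⟩ := HenselianLocalRing.is_henselian _ (monic_monicOf a) x h₁ h₂
    refine ⟨y, y.2, ?_, ?_⟩
    · rw [heval, hy.eq_zero]; rfl
    · rw [← isSmall_iff] at hyx
      exact hyx
  · intro h
    refine ⟨fun f hf x h₁ h₂ => ?_⟩
    rw [eq_monicOf hf rfl] at h₁ h₂ ⊢
    set a : Fin f.natDegree → v := fun i => f.coeff i
    obtain ⟨y, hyv, hy, hyx⟩ := h _ (fun i => (a i : K)) x (fun i => (a i).2) x.2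
      (by rwa [heval, isSmall_iff])
      (by rwa [hder, isSmall_iff, mem_maximalIdeal, mem_nonunits_iff, not_not])
    lift y to v using hyv
    refine ⟨y, Subtype.val_injective ?_, ?_⟩
    · rw [← heval, hy]; rfl
    · rw [← isSmall_iff]
      exact hyx

theorem ValuedFieldEquiv.henselianLocalRing_iff {v : ValuationSubring K} {w : ValuationSubring L}
    (h : ValuedFieldEquiv v w) : HenselianLocalRing v ↔ HenselianLocalRing w := by
  rw [CanonicalHenselian.henselianLocalRing_iff, CanonicalHenselian.henselianLocalRing_iff]
  refine forall_congr' fun n => SameDef.iff_of_elementarilyEquivalent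
    (sM := setStructure (v : Set K)) (sN := setStructure (w : Set L)) ?_ h
  refine SameDef.all_tuple (SameDef.all (SameDef.imp (SameDef.finite_all fun i =>
    (SameTerm.var _).mem) (SameDef.imp (SameTerm.var _).mem (SameDef.imp
    (SameTerm.isSmall (SamePoly.eval_monicOf (fun i => SameTerm.var _) (SameTerm.var _)))
    (SameDef.imp (SameDef.not (SameTerm.isSmall (SamePoly.eval_derivative_monicOf
    (fun i => SameTerm.var _) (SameTerm.var _)))) (SameDef.ex (SameDef.and (SameTerm.var _).mem
    (SameDef.and (SameTerm.equal (SameTerm.lift _ _ (SamePoly.eval_monicOf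
    (fun i => SameTerm.var _) (SameTerm.var _))) (SameTerm.zero.lift _ _))
    (SameTerm.isSmall (SameTerm.sub (SameTerm.var _) (SameTerm.var _)))))))))))

theorem eq_top_iff_forall_mem {v : ValuationSubring K} : v = ⊤ ↔ ∀ x, x ∈ (v : Set K) :=
  ⟨fun hv x => by rw [hv]; exact ValuationSubring.mem_top x, fun hv => eq_top_iff.2 fun x _ => hv x⟩

theorem ValuedFieldEquiv.eq_top_iff {v : ValuationSubring K} {w : ValuationSubring L}
    (h : ValuedFieldEquiv v w) : v = ⊤ ↔ w = ⊤ := by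
  rw [eq_top_iff_forall_mem, eq_top_iff_forall_mem]
  exact SameDef.iff_of_elementarilyEquivalent
    (sM := setStructure (v : Set K)) (sN := setStructure (w : Set L))
    (SameDef.all (SameTerm.var _).mem) h

/-- The residue map, extended by `0` outside of the valuation ring. -/
def residueMap (v : ValuationSubring K) (x : K) : ResidueField v :=
  open Classical in if h : x ∈ v then residue v ⟨x, h⟩ else 0

theorem residueMap_of_mem {v : ValuationSubring K} {x : K} (h : x ∈ v) :
    residueMap v x = residue v ⟨x, h⟩ := dif_pos h

theorem exists_residueMap_eq (v : ValuationSubring K) (y : ResidueField v) :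
    ∃ x, x ∈ v ∧ residueMap v x = y := by
  obtain ⟨x, rfl⟩ := residue_surjective y
  exact ⟨x, x.2, residueMap_of_mem x.2⟩

theorem residueMap_eq_iff {v : ValuationSubring K} {x y : K} (hx : x ∈ v) (hy : y ∈ v) :
    IsSmall (v : Set K) (x - y) ↔ residueMap v x = residueMap v y := by
  rw [residueMap_of_mem hx, residueMap_of_mem hy, ← sub_eq_zero, ← map_sub, residue_eq_zero_iff,
    ← isSmall_iff]
  rfl

/-- The terms of the language of rings commute with the residue map. -/
theorem residueMap_realize (v : ValuationSubring K) (t : Language.ring.Term α) (x : α → K)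
    (hx : ∀ i, x i ∈ v) : @Term.realize _ _ (ringStructure K) _ x t ∈ v ∧
      residueMap v (@Term.realize _ _ (ringStructure K) _ x t) =
        @Term.realize _ _ (ringStructure (ResidueField v)) _ (residueMap v ∘ x) t := by
  induction t with
  | var i => exact ⟨hx i, rfl⟩
  | func f ts ih =>
    have h₁ := fun i => (ih i).1
    have h₂ := fun i => (ih i).2
    simp only [Term.realize]
    cases f with
    | add =>
      refine ⟨v.add_mem _ _ (h₁ 0) (h₁ 1), (residueMap_of_mem (v.add_mem _ _ (h₁ 0) (h₁ 1))).trans ?_⟩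
      simp only [← h₂, residueMap_of_mem (h₁ _)]
      exact map_add (residue v) ⟨_, h₁ 0⟩ ⟨_, h₁ 1⟩
    | mul =>
      refine ⟨v.mul_mem _ _ (h₁ 0) (h₁ 1), (residueMap_of_mem (v.mul_mem _ _ (h₁ 0) (h₁ 1))).trans ?_⟩
      simp only [← h₂, residueMap_of_mem (h₁ _)]
      exact map_mul (residue v) ⟨_, h₁ 0⟩ ⟨_, h₁ 1⟩
    | neg =>
      refine ⟨v.neg_mem _ (h₁ 0), (residueMap_of_mem (v.neg_mem _ (h₁ 0))).trans ?_⟩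
      simp only [← h₂, residueMap_of_mem (h₁ _)]
      exact map_neg (residue v) ⟨_, h₁ 0⟩
    | zero => exact ⟨v.zero_mem, (residueMap_of_mem v.zero_mem).trans (map_zero (residue v))⟩
    | one => exact ⟨v.one_mem, (residueMap_of_mem v.one_mem).trans (map_one (residue v))⟩

/-- Elementarily equivalent valued fields have elementarily equivalent residue fields. -/
theorem ValuedFieldEquiv.residueField {v : ValuationSubring K} {w : ValuationSubring L}
    (h : ValuedFieldEquiv v w) : FieldEquiv (ResidueField v) (ResidueField w) := by
  let _ := ringStructure (ResidueField v)
  let _ := ringStructure (ResidueField w)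
  refine elementarilyEquivalent_of_interpretation (sM := setStructure (v : Set K))
    (sN := setStructure (w : Set L)) (fun x => x ∈ (v : Set K)) (fun x => x ∈ (w : Set L))
    (residueMap v) (residueMap w) (exists_residueMap_eq v) (exists_residueMap_eq w)
    (SameTerm.var ()).mem (fun t => ?_) ?_ (fun R => ?_) h
  · exact ⟨_, _, SameTerm.lift _ _ ⟨t, fun _ => rfl, fun _ => rfl⟩, residueMap_realize v t,
      residueMap_realize w t⟩
  · exact ⟨_, _, ((SameTerm.var 0).sub (SameTerm.var 1)).isSmall,
      fun x hx => residueMap_eq_iff (hx 0) (hx 1), fun y hy => residueMap_eq_iff (hy 0) (hy 1)⟩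
  · exact isEmptyElim R

/-- Expanding elementarily equivalent fields by the sets that a formula defines in them gives
elementarily equivalent structures. -/
theorem FieldEquiv.definedSet (h : FieldEquiv K L) (φ : Language.ring.Formula (Fin 1)) :
    @ElementarilyEquivalent valuedLang K L (setStructure (definedSet φ K))
      (setStructure (definedSet φ L)) := by
  let sK := setStructure (CanonicalHenselian.definedSet φ K)
  let sL := setStructure (CanonicalHenselian.definedSet φ L)
  have hterm : ∀ {α : Type} (t : valuedLang.Term α), SameTerm (ringStructure K) (ringStructure L)
      (fun x => t.realize x) (fun y => t.realize y) := by
    intro α t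
    induction t with
    | var i => exact SameTerm.var i
    | func f ts ih =>
      rcases f with f | f
      · choose t htK htL using ih
        refine ⟨Term.func f t, fun x => ?_, fun y => ?_⟩
        · simp only [Term.realize, htK]; rfl
        · simp only [Term.realize, htL]; rfl
      · exact f.elim
  refine elementarilyEquivalent_of_interpretation (sM := ringStructure K) (sN := ringStructure L)
    (fun _ => True) (fun _ => True) id id (fun x => ⟨x, trivial, rfl⟩) (fun y => ⟨y, trivial, rfl⟩)
    (SameDef.false.imp SameDef.false |>.congr (by simp) (by simp))
    (fun t => ⟨_, _, hterm t, fun _ _ => ⟨trivial, rfl⟩, fun _ _ => ⟨trivial, rfl⟩⟩)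
    ⟨_, _, (SameTerm.var 0).equal (SameTerm.var 1), fun _ _ => Iff.rfl, fun _ _ => Iff.rfl⟩
    (fun R => ?_) h
  rcases R with R | R
  · exact isEmptyElim R
  · cases R with
    | mem =>
      refine ⟨_, _, SameDef.comp ⟨φ, fun _ => Iff.rfl, fun _ => Iff.rfl⟩ (fun _ => 0),
        fun x _ => Iff.rfl, fun y _ => Iff.rfl⟩

end Valued

end CanonicalHenselian

namespace CanonicalHenselian

open FirstOrder FirstOrder.Language

variable {K : Type*} [Field K] {α : Type}

/-! ### Compactness for valued fields -/

/-- A structure that is elementarily equivalent to a field with a distinguished subset is itself of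
that form. -/
theorem exists_setStructure_eq (S : Set K) {M : Type*} (sM : valuedLang.Structure M)
    (h : @ElementarilyEquivalent valuedLang K M (setStructure S) sM) :
    ∃ (_ : Field M) (T : Set M), setStructure T = sM := by
  let _ := Ring.compatibleRingOfRing K
  let _ := predStructure S
  let _ : Language.ring.Structure M :=
    (LHom.sumInl : Language.ring →ᴸ valuedLang).reduct M
  have : Theory.field.Model M := by
    refine ⟨fun φ hφ => ?_⟩
    have h₁ : K ⊨ φ := Theory.realize_sentence_of_mem Theory.field hφ
    rw [← LHom.realize_onSentence M (LHom.sumInl : Language.ring →ᴸ valuedLang)]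
    refine (elementarilyEquivalent_iff.1 h _).1 ?_
    exact (LHom.realize_onSentence K (LHom.sumInl : Language.ring →ᴸ valuedLang) φ).2 h₁
  let _ := Field.fieldOfModelField M
  let hcomp := Field.compatibleRingOfModelField M
  refine ⟨inferInstance, {x | sM.RelMap (Sum.inr PredRel.mem : valuedLang.Relations 1) ![x]},
    Structure.ext ?_ ?_⟩
  -- the operations of the field `M` are by construction those of the given structure
  · funext n f x
    rcases f with f | f
    · cases f with
      | add => exact (hcomp.funMap_add x).symm
      | mul => exact (hcomp.funMap_mul x).symm
      | neg => exact (hcomp.funMap_neg x).symm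
      | zero => exact (hcomp.funMap_zero x).symm
      | one => exact (hcomp.funMap_one x).symm
    · exact f.elim
  · funext n R x
    rcases R with R | R
    · exact isEmptyElim R
    · cases R with
      | mem =>
        refine propext ?_
        change sM.RelMap (Sum.inr PredRel.mem : valuedLang.Relations 1) ![x 0] ↔ _
        rw [show ![x 0] = x by ext i; fin_cases i; rfl]

/-- The compactness theorem for valued fields that are elementarily equivalent to `(K, v)`: if
every finite subset of `Γ` is realized in such a valued field, then so is `Γ`. The realization can
be found in `Type`, whatever universes the finite realizations come from. -/
theorem exists_realization_of_finite (v : ValuationSubring K) (Γ : Set (valuedLang.Formula α))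
    (h : ∀ Γ₀ ⊆ Γ, Γ₀.Finite → ∃ (F : Type w) (_ : Field F) (u : ValuationSubring F) (x : α → F),
      ValuedFieldEquiv v u ∧ ∀ φ ∈ Γ₀, @Formula.Realize _ _ (valuedStructure u) _ φ x) :
    ∃ (F : Type) (_ : Field F) (u : ValuationSubring F) (x : α → F),
      ValuedFieldEquiv v u ∧ ∀ φ ∈ Γ, @Formula.Realize _ _ (valuedStructure u) _ φ x := by
  classical
  let sK := valuedStructure v
  let Tc : valuedLang.Theory := valuedLang.completeTheory K
  let Θ : valuedLang[[α]].Theory :=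
    (valuedLang.lhomWithConstants α).onTheory Tc ∪ Formula.equivSentence '' Γ
  have hsat : Θ.IsSatisfiable := by
    rw [Theory.isSatisfiable_iff_isFinitelySatisfiable]
    intro Θ₀ hΘ₀
    obtain ⟨F, _, u, x, hu, hx⟩ := h (Γ ∩ Formula.equivSentence ⁻¹' Θ₀) Set.inter_subset_left
      ((Θ₀.finite_toSet.preimage Formula.equivSentence.injective.injOn).inter_of_right _)
    let _ := valuedStructure u
    let _ := constantsOn.structure x
    have : Nonempty F := ⟨0⟩
    have : F ⊨ (Θ₀ : valuedLang[[α]].Theory) := by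
      refine ⟨fun σ hσ => ?_⟩
      rcases hΘ₀ hσ with ⟨τ, hτ, rfl⟩ | ⟨φ, hφ, rfl⟩
      · rw [LHom.realize_onSentence]
        exact (elementarilyEquivalent_iff.1 hu τ).1 hτ
      · rw [Formula.realize_equivSentence]
        exact hx φ ⟨hφ, hσ⟩
    exact Theory.Model.isSatisfiable F
  obtain ⟨M⟩ := hsat
  let sM : valuedLang.Structure M := (valuedLang.lhomWithConstants α).reduct M
  have hM : K ≅[valuedLang] M := by
    have hmodel : M ⊨ Tc := by
      refine ⟨fun σ hσ => ?_⟩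
      rw [← LHom.realize_onSentence M (valuedLang.lhomWithConstants α)]
      exact Theory.realize_sentence_of_mem Θ (Or.inl ⟨σ, hσ, rfl⟩)
    exact elementarilyEquivalent_iff.2 fun φ => (realize_iff_of_model_completeTheory K M φ).symm
  obtain ⟨_, T, hT⟩ := exists_setStructure_eq (v : Set K) sM hM
  obtain ⟨u, rfl⟩ := exists_valuationSubring_of_elementarilyEquivalent v (T := T) (by rwa [hT])
  refine ⟨M, inferInstance, u, fun a => (valuedLang.con a : M), ?_, fun φ hφ => ?_⟩
  · change @ElementarilyEquivalent valuedLang K M _ (setStructure (u : Set M))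
    rwa [hT]
  · change @Formula.Realize _ _ (setStructure (u : Set M)) _ _ _
    rw [hT, ← Formula.realize_equivSentence]
    exact Theory.realize_sentence_of_mem Θ (Or.inr ⟨φ, hφ, rfl⟩)

end CanonicalHenselian

namespace CanonicalHenselian

open FirstOrder FirstOrder.Language

variable {Lang : Language} {α β γ : Type}

/-! ### Normal forms of `∃∀`-formulas -/

/-- Universal quantification over the last `n` bound variables. -/
theorem exists_isUniversal_forall_append {m : ℕ} (n : ℕ) (θ : Lang.BoundedFormula α (m + n))
    (hθ : θ.IsUniversal) : ∃ θ' : Lang.BoundedFormula α m, θ'.IsUniversal ∧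
      ∀ (M : Type) [Lang.Structure M] (v : α → M) (xs : Fin m → M),
        θ'.Realize v xs ↔ ∀ ys : Fin n → M, θ.Realize v (Fin.append xs ys) := by
  induction n with
  | zero =>
    refine ⟨θ, hθ, fun M _ v xs => ?_⟩
    rw [Unique.forall_iff, Subsingleton.elim (default : Fin 0 → M) Fin.elim0, Fin.append_elim0]
    rfl
  | succ n ih =>
    obtain ⟨θ', hθ', h⟩ := ih (BoundedFormula.all (n := m + n) θ) hθ.all
    refine ⟨θ', hθ', fun M _ v xs => (h M v xs).trans ⟨fun H ys => ?_, fun H ys a => ?_⟩⟩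
    · have := H (Fin.init ys) (ys (Fin.last n))
      rwa [← Fin.append_snoc, Fin.snoc_init_self] at this
    · rw [← Fin.append_snoc]
      exact H _

theorem IsExistsForall.exs {m : ℕ} {θ : Lang.BoundedFormula α m} (hθ : IsExistsForall θ) :
    IsExistsForall θ.exs := by
  induction m with
  | zero => exact hθ
  | succ m ih => exact ih hθ.ex

/-- For a quantifier-free formula `ψ`, the condition `∃ b, ∀ c, ψ` on `v`, with tuples `b` and `c`,
is expressed by an `∃∀`-formula. -/
theorem exists_isExistsForall [Finite β] [Finite γ] (ψ : Lang.Formula (α ⊕ (β ⊕ γ))) (hψ : ψ.IsQF) :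
    ∃ φ : Lang.Formula α, IsExistsForall φ ∧ ∀ (M : Type) [Lang.Structure M] (v : α → M),
      φ.Realize v ↔ ∃ b : β → M, ∀ c : γ → M, ψ.Realize (Sum.elim v (Sum.elim b c)) := by
  obtain ⟨m, ⟨e⟩⟩ := Finite.exists_equiv_fin β
  obtain ⟨n, ⟨e'⟩⟩ := Finite.exists_equiv_fin γ
  let g : α ⊕ (β ⊕ γ) → α ⊕ Fin (m + n) := Sum.elim Sum.inl
    (Sum.elim (fun b => Sum.inr (Fin.castAdd n (e b))) fun c => Sum.inr (Fin.natAdd m (e' c)))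
  let θ₀ : Lang.BoundedFormula α (m + n) := BoundedFormula.relabel g ψ
  obtain ⟨θ, hθ, h⟩ := exists_isUniversal_forall_append n θ₀ (hψ.relabel g).isUniversal
  have key : ∀ (M : Type) [Lang.Structure M] (v : α → M) (xs : Fin m → M) (ys : Fin n → M),
      θ₀.Realize v (Fin.append xs ys) ↔ ψ.Realize (Sum.elim v (Sum.elim (xs ∘ e) (ys ∘ e'))) := by
    intro M _ v xs ys
    refine BoundedFormula.realize_relabel.trans ?_
    rw [Formula.Realize]
    refine iff_of_eq (congrArg₂ _ (funext fun i => ?_) (Subsingleton.elim _ _))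
    rcases i with i | i | i
    · rfl
    · exact Fin.append_left xs ys (e i)
    · exact Fin.append_right xs ys (e' i)
  refine ⟨θ.exs, (IsExistsForall.of_isUniversal hθ).exs, fun M _ v => ?_⟩
  rw [BoundedFormula.realize_exs]
  constructor
  · rintro ⟨xs, hxs⟩
    refine ⟨xs ∘ e, fun c => ?_⟩
    have := (key M v xs (c ∘ e'.symm)).1 ((h M v xs).1 hxs _)
    rwa [Function.comp_assoc, Equiv.symm_comp_self, Function.comp_id] at this
  · rintro ⟨b, hb⟩
    refine ⟨b ∘ e.symm, (h M v _).2 fun ys => (key M v _ ys).2 ?_⟩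
    rw [Function.comp_assoc, Equiv.symm_comp_self, Function.comp_id]
    exact hb _

/-- A formula is of type `∃∀` if, in all structures, it expresses a condition of the form
`∃ b, ∀ c, ψ` with tuples `b` and `c` and a quantifier-free formula `ψ`. -/
def IsExistsForallType (φ : Lang.Formula α) : Prop :=
  ∃ (β γ : Type) (_ : Finite β) (_ : Finite γ) (ψ : Lang.Formula (α ⊕ (β ⊕ γ))), ψ.IsQF ∧
    ∀ (M : Type) [Lang.Structure M] (v : α → M),
      φ.Realize v ↔ ∃ b : β → M, ∀ c : γ → M, ψ.Realize (Sum.elim v (Sum.elim b c))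

theorem IsExistsForallType.bot : IsExistsForallType (⊥ : Lang.Formula α) := by
  refine ⟨Empty, Empty, inferInstance, inferInstance, ⊥, BoundedFormula.isQF_bot, fun M _ v => ?_⟩
  simp [Formula.Realize]

/-- The quantified tuples of a disjunction are the disjoint unions of those of its members. -/
theorem IsExistsForallType.exists_sup {φ₁ φ₂ : Lang.Formula α} (h₁ : IsExistsForallType φ₁)
    (h₂ : IsExistsForallType φ₂) : ∃ φ : Lang.Formula α, IsExistsForallType φ ∧
      ∀ (M : Type) [Lang.Structure M] [Nonempty M] (v : α → M),
        φ.Realize v ↔ φ₁.Realize v ∨ φ₂.Realize v := by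
  obtain ⟨β₁, γ₁, _, _, ψ₁, hψ₁, h₁⟩ := h₁
  obtain ⟨β₂, γ₂, _, _, ψ₂, hψ₂, h₂⟩ := h₂
  let ψ : Lang.Formula (α ⊕ ((β₁ ⊕ β₂) ⊕ (γ₁ ⊕ γ₂))) :=
    (ψ₁.relabel (Sum.map id (Sum.map Sum.inl Sum.inl))) ⊔
      (ψ₂.relabel (Sum.map id (Sum.map Sum.inr Sum.inr)))
  have hψ : ψ.IsQF := (hψ₁.relabel _).sup (hψ₂.relabel _)
  obtain ⟨φ, -, hφ⟩ := exists_isExistsForall ψ hψ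
  have key : ∀ (M : Type) [Lang.Structure M] (v : α → M) (b : β₁ ⊕ β₂ → M) (c : γ₁ ⊕ γ₂ → M),
      ψ.Realize (Sum.elim v (Sum.elim b c)) ↔
        ψ₁.Realize (Sum.elim v (Sum.elim (b ∘ Sum.inl) (c ∘ Sum.inl))) ∨
        ψ₂.Realize (Sum.elim v (Sum.elim (b ∘ Sum.inr) (c ∘ Sum.inr))) := by
    intro M _ v b c
    refine Formula.realize_sup.trans (or_congr ?_ ?_)
    all_goals
      rw [Formula.realize_relabel]
      refine iff_of_eq (congrArg _ (funext fun i => ?_))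
      rcases i with i | i | i <;> rfl
  refine ⟨φ, ⟨_, _, inferInstance, inferInstance, ψ, hψ, hφ⟩, fun M _ _ v => ?_⟩
  rw [hφ, h₁, h₂]
  constructor
  · rintro ⟨b, hb⟩
    by_contra! hcon
    obtain ⟨c₁, hc₁⟩ := hcon.1 (b ∘ Sum.inl)
    obtain ⟨c₂, hc₂⟩ := hcon.2 (b ∘ Sum.inr)
    exact ((key M v b (Sum.elim c₁ c₂)).1 (hb _)).elim hc₁ hc₂
  · inhabit M
    rintro (⟨b, hb⟩ | ⟨b, hb⟩)
    · exact ⟨Sum.elim b default, fun c => (key _ _ _ _).2 (Or.inl (hb _))⟩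
    · exact ⟨Sum.elim default b, fun c => (key _ _ _ _).2 (Or.inr (hb _))⟩

theorem IsExistsForallType.exists_isExistsForall {φ : Lang.Formula α} (h : IsExistsForallType φ) :
    ∃ φ' : Lang.Formula α, IsExistsForall φ' ∧
      ∀ (M : Type) [Lang.Structure M] (v : α → M), φ'.Realize v ↔ φ.Realize v := by
  obtain ⟨β, γ, _, _, ψ, hψ, h⟩ := h
  obtain ⟨φ', hφ', h'⟩ := CanonicalHenselian.exists_isExistsForall ψ hψ
  exact ⟨φ', hφ', fun M _ v => (h' M v).trans (h M v).symm⟩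

theorem isQF_restrictFreeVar [DecidableEq α] {n : ℕ} {φ : Lang.BoundedFormula α n} (hφ : φ.IsQF)
    (f : φ.freeVarFinset → β) : (φ.restrictFreeVar f).IsQF := by
  induction hφ with
  | falsum => exact BoundedFormula.IsQF.falsum
  | of_isAtomic h =>
    cases h with
    | equal t₁ t₂ => exact (BoundedFormula.IsAtomic.equal _ _).isQF
    | rel R ts => exact (BoundedFormula.IsAtomic.rel _ _).isQF
  | imp _ _ ih₁ ih₂ => exact (ih₁ _).imp (ih₂ _)

theorem exists_isQF_forall {s : Set (Lang.Formula α)} (hs : s.Finite) (h : ∀ φ ∈ s, φ.IsQF) :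
    ∃ ψ : Lang.Formula α, ψ.IsQF ∧ ∀ (M : Type) [Lang.Structure M] (v : α → M),
      ψ.Realize v ↔ ∀ φ ∈ s, φ.Realize v := by
  induction s, hs using Set.Finite.induction_on with
  | empty => exact ⟨⊤, BoundedFormula.IsQF.top, fun M _ v => by simp⟩
  | @insert φ s _ _ ih =>
    obtain ⟨ψ, hψ, hr⟩ := ih fun φ hφ => h φ (Set.mem_insert_of_mem _ hφ)
    refine ⟨φ ⊓ ψ, (h φ (Set.mem_insert _ _)).inf hψ, fun M _ v => ?_⟩
    rw [Formula.realize_inf, hr, Set.forall_mem_insert]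

end CanonicalHenselian

namespace CanonicalHenselian

open FirstOrder FirstOrder.Language IsLocalRing Polynomial

/-! ### Elementary equivalence and the residue field -/

theorem FieldEquiv.of_ringEquiv {k k' : Type*} [Field k] [Field k'] (e : k ≃+* k') :
    FieldEquiv k k' := by
  let _ := Ring.compatibleRingOfRing k
  let _ := Ring.compatibleRingOfRing k'
  exact StrongHomClass.elementarilyEquivalent (Ring.languageEquivEquivRingEquiv.symm e)

theorem ValuedFieldEquiv.fieldEquiv {K L : Type*} [Field K] [Field L] {v : ValuationSubring K}
    {w : ValuationSubring L} (h : ValuedFieldEquiv v w) : FieldEquiv K L := by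
  let _ := ringStructure K
  let _ := ringStructure L
  refine elementarilyEquivalent_iff.2 fun φ => ?_
  refine (realize_onFormula_sumInl (v : Set K) φ default).symm.trans
    (Iff.trans ?_ (realize_onFormula_sumInl (w : Set L) φ default))
  exact SameDef.iff_of_elementarilyEquivalent (sM := setStructure (v : Set K))
    (sN := setStructure (w : Set L)) ⟨LHom.sumInl.onFormula φ,
      fun x => by rw [Subsingleton.elim x default], fun x => by rw [Subsingleton.elim x default]⟩ h

/-- Every valued field is elementarily equivalent to one in `Type`. -/
theorem exists_valuedFieldEquiv {K : Type w} [Field K] (v : ValuationSubring K) :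
    ∃ (F : Type) (_ : Field F) (u : ValuationSubring F), ValuedFieldEquiv v u := by
  obtain ⟨F, _, u, -, hu, -⟩ := exists_realization_of_finite (α := Empty) v ∅
    fun Γ₀ hΓ₀ _ => ⟨K, inferInstance, v, Empty.elim, rfl, fun φ hφ => (hΓ₀ hφ).elim⟩
  exact ⟨F, _, u, hu⟩

/-- A field that is not t-henselian is elementarily equivalent to no henselian field, in any
universe. -/
theorem FieldEquiv.not_isHenselianField {k : Type u} {F : Type w} [Field k] [Field F]
    (h : FieldEquiv k F) (hk : ¬ IsTHenselian k) : ¬ IsHenselianField F := by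
  rintro ⟨v, hv, hens⟩
  obtain ⟨F₀, _, u, hu⟩ := exists_valuedFieldEquiv v
  refine hk ⟨ULift.{u} F₀, inferInstance, ?_, ?_⟩
  · exact Eq.trans (Eq.trans h hu.fieldEquiv) (FieldEquiv.of_ringEquiv ULift.ringEquiv.symm)
  · exact IsHenselianField.of_ringEquiv ULift.ringEquiv.symm
      ⟨u, fun h => hv (hu.eq_top_iff.2 h), hu.henselianLocalRing_iff.1 hens⟩

/-- A valuation is henselian and its residue field is neither separably closed nor henselian. Such a
valuation is finer than every henselian valuation on the field. -/
structure HasIsolatedResidueField {K : Type*} [Field K] (v : ValuationSubring K) : Prop where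
  henselian : HenselianLocalRing v
  not_isSepClosed : ¬ IsSepClosed (ResidueField v)
  not_isHenselianField : ¬ IsHenselianField (ResidueField v)

theorem ValuedFieldEquiv.hasIsolatedResidueField {K : Type u} {L : Type w} [Field K] [Field L]
    {v : ValuationSubring K} {w : ValuationSubring L} (h : ValuedFieldEquiv v w) (hv : v ∈ H₁ K)
    (ht : ¬ IsTHenselian (ResidueField v)) : HasIsolatedResidueField w where
  henselian := h.henselianLocalRing_iff.1 hv.1
  not_isSepClosed := fun hw => hv.2 (h.residueField.isSepClosed_iff.2 hw)
  not_isHenselianField := h.residueField.not_isHenselianField ht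

/-! ### The defining formula -/

/-- Realization of a formula of the language of rings in a field. -/
abbrev RingRealize {α : Type} (φ : Language.ring.Formula α) {F : Type*} [Field F] (x : α → F) :
    Prop :=
  @Formula.Realize _ _ (ringStructure F) _ φ x

section Diagram

variable {F F' : Type} [Field F] [Field F']

/-- Let `x : F → F'` satisfy the quantifier-free formulas `ψ(x, y)`, for all `y`, that hold in `F` for
all `y` when the elements of `F` name themselves. Then `x` preserves the identities in one variable
between terms. -/
theorem SameTerm.forall_eq {x : F → F'}
    (hx : ∀ ψ : Language.ring.Formula (F ⊕ Unit), ψ.IsQF →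
      (∀ y : F, RingRealize ψ (Sum.elim id fun _ => y)) →
      ∀ y : F', RingRealize ψ (Sum.elim x fun _ => y))
    {f₁ f₂ : (F ⊕ Unit → F) → F} {g₁ g₂ : (F ⊕ Unit → F') → F'}
    (h₁ : SameTerm (ringStructure F) (ringStructure F') f₁ g₁)
    (h₂ : SameTerm (ringStructure F) (ringStructure F') f₂ g₂)
    (h : ∀ y, f₁ (Sum.elim id fun _ => y) = f₂ (Sum.elim id fun _ => y)) (y : F') :
    g₁ (Sum.elim x fun _ => y) = g₂ (Sum.elim x fun _ => y) := by
  obtain ⟨t₁, hF₁, hF₁'⟩ := h₁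
  obtain ⟨t₂, hF₂, hF₂'⟩ := h₂
  let _ := ringStructure F
  let _ := ringStructure F'
  have := hx (t₁.equal t₂) (BoundedFormula.IsAtomic.equal _ _).isQF
    (fun y => Formula.realize_equal.2 (by rw [hF₁, hF₂, h])) y
  rwa [RingRealize, Formula.realize_equal, hF₁', hF₂'] at this

theorem SameTerm.forall_ne {x : F → F'}
    (hx : ∀ ψ : Language.ring.Formula (F ⊕ Unit), ψ.IsQF →
      (∀ y : F, RingRealize ψ (Sum.elim id fun _ => y)) →
      ∀ y : F', RingRealize ψ (Sum.elim x fun _ => y))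
    {f₁ f₂ : (F ⊕ Unit → F) → F} {g₁ g₂ : (F ⊕ Unit → F') → F'}
    (h₁ : SameTerm (ringStructure F) (ringStructure F') f₁ g₁)
    (h₂ : SameTerm (ringStructure F) (ringStructure F') f₂ g₂)
    (h : ∀ y, f₁ (Sum.elim id fun _ => y) ≠ f₂ (Sum.elim id fun _ => y)) (y : F') :
    g₁ (Sum.elim x fun _ => y) ≠ g₂ (Sum.elim x fun _ => y) := by
  obtain ⟨t₁, hF₁, hF₁'⟩ := h₁
  obtain ⟨t₂, hF₂, hF₂'⟩ := h₂
  let _ := ringStructure F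
  let _ := ringStructure F'
  have := hx (t₁.equal t₂).not (BoundedFormula.IsAtomic.equal _ _).isQF.not
    (fun y => by rw [RingRealize, Formula.realize_not, Formula.realize_equal, hF₁, hF₂]; exact h y) y
  rwa [RingRealize, Formula.realize_not, Formula.realize_equal, hF₁', hF₂'] at this

/-- A map that preserves the universal formulas in one variable is an embedding onto a relatively
algebraically closed subfield. -/
theorem exists_ringHom_of_preserves {x : F → F'}
    (hx : ∀ ψ : Language.ring.Formula (F ⊕ Unit), ψ.IsQF →
      (∀ y : F, RingRealize ψ (Sum.elim id fun _ => y)) →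
      ∀ y : F', RingRealize ψ (Sum.elim x fun _ => y)) :
    ∃ i : F →+* F', (∀ c, i c = x c) ∧
      ∀ p : F[X], p.Monic → (∀ y, p.eval y ≠ 0) → ∀ y : F', p.eval₂ i y ≠ 0 := by
  let i : F →+* F' :=
    { toFun := x
      map_one' := SameTerm.forall_eq hx (SameTerm.var (Sum.inl 1)) SameTerm.one (fun _ => rfl) 0
      map_zero' := SameTerm.forall_eq hx (SameTerm.var (Sum.inl 0)) SameTerm.zero (fun _ => rfl) 0
      map_add' := fun a b => SameTerm.forall_eq hx (SameTerm.var (Sum.inl (a + b)))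
        ((SameTerm.var (Sum.inl a)).add (SameTerm.var (Sum.inl b))) (fun _ => rfl) 0
      map_mul' := fun a b => SameTerm.forall_eq hx (SameTerm.var (Sum.inl (a * b)))
        ((SameTerm.var (Sum.inl a)).mul (SameTerm.var (Sum.inl b))) (fun _ => rfl) 0 }
  refine ⟨i, fun _ => rfl, fun p hp hroot y => ?_⟩
  have := SameTerm.forall_ne hx (SamePoly.eval_monicOf
    (fun j : Fin p.natDegree => SameTerm.var (Sum.inl (p.coeff j))) (SameTerm.var (Sum.inr ())))
    SameTerm.zero (fun y => ?_) y
  · rw [eq_monicOf hp rfl, eval₂_eq_eval_map, map_monicOf]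
    exact this
  · have := hroot y
    rw [eq_monicOf hp rfl] at this
    exact this

end Diagram

theorem exists_finite_subset_insert_image {ι κ : Type*} {f : ι → κ} {μ : κ} {Δ : Set ι} {Γ₀ : Set κ}
    (h : Γ₀ ⊆ insert μ (f '' Δ)) (hfin : Γ₀.Finite) :
    ∃ Δ₀ ⊆ Δ, Δ₀.Finite ∧ Γ₀ ⊆ insert μ (f '' Δ₀) := by
  obtain ⟨Δ₀, hΔ₀, hfin₀, heq⟩ := Set.exists_subset_image_finite_and.1
    ⟨Γ₀ \ {μ}, fun φ hφ => (h hφ.1).resolve_left hφ.2, hfin.sdiff, rfl⟩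
  refine ⟨Δ₀, hΔ₀, hfin₀, fun φ hφ => ?_⟩
  by_cases hφμ : φ = μ
  · exact Or.inl hφμ
  · rw [← heq]
    exact Or.inr ⟨hφ, hφμ⟩

variable {K : Type u} [Field K] {vK : ValuationSubring K}

/-- Suppose that `x : F → F'` preserves the quantifier-free formulas `ψ(x, y)` that hold in `F` for
all `y`. Then `x` embeds `F` as a relatively algebraically closed subfield, the valuation on `F'`
restricts to a henselian valuation on `F`, and this one is coarser than `u`, so that `x` maps the
elements of `u` into the valuation ring of `F'`. By compactness, for a given element `c` of `u` this
depends on a single formula `ψ`. -/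
theorem exists_isQF_of_mem (hv : vK ∈ H₁ K) (ht : ¬ IsTHenselian (ResidueField vK)) {F : Type}
    [Field F] {u : ValuationSubring F} (hu : ValuedFieldEquiv vK u) {c : F} (hc : c ∈ u) :
    ∃ ψ : Language.ring.Formula (F ⊕ Unit), ψ.IsQF ∧
      (∀ y : F, RingRealize ψ (Sum.elim id fun _ => y)) ∧
      ∀ (F' : Type) [Field F'] (u' : ValuationSubring F') (x : F → F'), ValuedFieldEquiv vK u' →
        (∀ y, RingRealize ψ (Sum.elim x fun _ => y)) → x c ∈ u' := by
  by_contra! hcon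
  -- `all ψ` is the universal closure of `ψ` in the variable `y`, and `μ` says that the element
  -- named by `c` is not in the valuation ring
  let Δ : Set (Language.ring.Formula (F ⊕ Unit)) :=
    {ψ | ψ.IsQF ∧ ∀ y : F, RingRealize ψ (Sum.elim id fun _ => y)}
  let all : Language.ring.Formula (F ⊕ Unit) → valuedLang.Formula F :=
    fun ψ => LHom.sumInl.onFormula (ψ.iAlls Unit)
  let μ : valuedLang.Formula F :=
    (Relations.formula₁ (Sum.inr PredRel.mem : valuedLang.Relations 1) (Term.var c)).not
  have hall : ∀ (F' : Type) [Field F'] (u' : ValuationSubring F') (x : F → F') ψ,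
      @Formula.Realize _ _ (valuedStructure u') _ (all ψ) x ↔
        ∀ y, RingRealize ψ (Sum.elim x fun _ => y) := by
    intro F' _ u' x ψ
    let _ := ringStructure F'
    refine (realize_onFormula_sumInl (u' : Set F') _ x).trans (Formula.realize_iAlls.trans ?_)
    exact ⟨fun h y => h fun _ => y, fun h y => h (y ())⟩
  have hμ : ∀ (F' : Type) [Field F'] (u' : ValuationSubring F') (x : F → F'),
      @Formula.Realize _ _ (valuedStructure u') _ μ x ↔ x c ∉ u' := by
    intro F' _ u' x
    let _ := valuedStructure u'
    exact Formula.realize_not.trans (not_congr Formula.realize_rel₁)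
  refine absurd (exists_realization_of_finite.{0} vK (insert μ (all '' Δ))
    fun Γ₀ hΓ₀ hfin => ?_) ?_
  · obtain ⟨Δ₀, hΔ₀, hfin₀, hsub⟩ := exists_finite_subset_insert_image hΓ₀ hfin
    obtain ⟨ψ, hψ, hreal⟩ := exists_isQF_forall hfin₀ fun φ hφ => (hΔ₀ hφ).1
    obtain ⟨F', _, u', x, hu', hx, hxc⟩ := hcon ψ hψ fun y => by
      let _ := ringStructure F
      exact (hreal F _).2 fun φ hφ => (hΔ₀ hφ).2 y
    refine ⟨F', inferInstance, u', x, hu', fun φ hφ => ?_⟩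
    rcases hsub hφ with rfl | ⟨ψ', hψ', rfl⟩
    · exact (hμ F' u' x).2 hxc
    · let _ := ringStructure F'
      exact (hall F' u' x ψ').2 fun y => (hreal F' _).1 (hx y) ψ' hψ'
  · rintro ⟨F', _, u', x, hu', hx⟩
    obtain ⟨i, hi, hroot⟩ := exists_ringHom_of_preserves (x := x) fun ψ hψ hψ' =>
      (hall F' u' x ψ).1 (hx _ (Set.mem_insert_of_mem _ ⟨ψ, ⟨hψ, hψ'⟩, rfl⟩))
    have hiso := hu.hasIsolatedResidueField hv ht
    have hcomap : u ≤ u'.comap i := le_of_henselian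
      (henselianLocalRing_comap i hroot (hu'.henselianLocalRing_iff.1 hv.1))
      hiso.not_isSepClosed hiso.not_isHenselianField
    refine (hμ F' u' x).1 (hx _ (Set.mem_insert _ _)) ?_
    rw [← hi]
    exact hcomap hc

/-- Every element of the valuation ring of a model satisfies an `∃∀`-formula that defines a subset of the
valuation ring in all models. -/
theorem exists_isExistsForallType_of_mem (hv : vK ∈ H₁ K) (ht : ¬ IsTHenselian (ResidueField vK))
    {F : Type} [Field F] {u : ValuationSubring F} (hu : ValuedFieldEquiv vK u) {c : F}
    (hc : c ∈ u) : ∃ φ : Language.ring.Formula (Fin 1), IsExistsForallType φ ∧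
      RingRealize φ (fun _ => c) ∧
      ∀ (F' : Type) [Field F'] (u' : ValuationSubring F') (x : Fin 1 → F'), ValuedFieldEquiv vK u' →
        RingRealize φ x → x 0 ∈ u' := by
  classical
  obtain ⟨ψ, hψ, hF, himp⟩ := exists_isQF_of_mem hv ht hu hc
  -- the name of `c` becomes the free variable, the other names are quantified existentially
  let f : ψ.freeVarFinset → Fin 1 ⊕ (ψ.freeVarFinset ⊕ Unit) := fun a =>
    Sum.elim (fun e => if e = c then Sum.inl 0 else Sum.inr (Sum.inl a))
      (fun _ => Sum.inr (Sum.inr ())) a.1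
  have hf : ∀ {F' : Type} (a : Fin 1 → F') (b : ψ.freeVarFinset → F') (x : F → F') (y : Unit → F'),
      x c = a 0 → (∀ e (he : Sum.inl e ∈ ψ.freeVarFinset), e ≠ c → x e = b ⟨_, he⟩) →
      ∀ i, (Sum.elim a (Sum.elim b y)) (f i) = (Sum.elim x y : F ⊕ Unit → F') i := by
    rintro F' a b x y hxc hx ⟨e | e, he⟩
    · by_cases hec : e = c
      · simp [f, hec, hxc]
      · simp [f, hec, hx e he hec]
    · simp [f]
  have hψ' : (BoundedFormula.restrictFreeVar ψ f).IsQF := isQF_restrictFreeVar hψ f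
  obtain ⟨φ, -, hφ⟩ := exists_isExistsForall (BoundedFormula.restrictFreeVar ψ f) hψ'
  refine ⟨φ, ⟨_, _, inferInstance, inferInstance, _, hψ', hφ⟩, ?_, fun F' _ u' a hu' ha => ?_⟩
  · let _ := ringStructure F
    refine (hφ F _).2 ⟨fun i => Sum.elim id (fun _ => 0) i.1, fun y => ?_⟩
    refine (BoundedFormula.realize_restrictFreeVar (Sum.elim id fun _ => y ()) ?_).2 (hF (y ()))
    exact hf _ _ id y rfl fun e he _ => rfl
  · let _ := ringStructure F'
    obtain ⟨b, hb⟩ := (hφ F' _).1 ha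
    let x : F → F' := fun e => if e = c then a 0 else
      if he : Sum.inl e ∈ ψ.freeVarFinset then b ⟨_, he⟩ else 0
    have hxc : x c = a 0 := if_pos rfl
    rw [← hxc]
    refine himp F' u' x hu' fun y => ?_
    refine (BoundedFormula.realize_restrictFreeVar (Sum.elim x fun _ => y) ?_).1 (hb fun _ => y)
    exact hf _ _ x _ hxc fun e he hec => by simp [x, hec, he]

theorem exists_isExistsForallType_sup {E : Set (Language.ring.Formula (Fin 1))} (hE : E.Finite)
    (h : ∀ φ ∈ E, IsExistsForallType φ) : ∃ φ : Language.ring.Formula (Fin 1),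
      IsExistsForallType φ ∧ ∀ (F : Type) [Field F] (x : Fin 1 → F),
        RingRealize φ x ↔ ∃ φ' ∈ E, RingRealize φ' x := by
  induction E, hE using Set.Finite.induction_on with
  | empty => exact ⟨⊥, IsExistsForallType.bot, fun F _ x => by simp [Formula.Realize]⟩
  | @insert φ₁ E _ _ ih =>
    obtain ⟨φ₂, hφ₂, hr₂⟩ := ih fun φ hφ => h φ (Set.mem_insert_of_mem _ hφ)
    obtain ⟨φ, hφ, hr⟩ := (h φ₁ (Set.mem_insert _ _)).exists_sup hφ₂
    refine ⟨φ, hφ, fun F _ x => ?_⟩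
    let _ := ringStructure F
    rw [Set.exists_mem_insert, ← hr₂ F x]
    exact hr F x

/-- A second application of compactness: finitely many of the formulas of
`exists_isExistsForallType_of_mem` cover the valuation ring in all models. -/
theorem exists_defining_formula (hv : vK ∈ H₁ K) (ht : ¬ IsTHenselian (ResidueField vK)) :
    ∃ φ : Language.ring.Formula (Fin 1), IsExistsForall φ ∧
      ∀ (F : Type) [Field F] (u : ValuationSubring F), ValuedFieldEquiv vK u →
        definedSet φ F = (u : Set F) := by
  -- the formulas of type `∃∀` that define a subset of the valuation ring in all models
  let E : Set (Language.ring.Formula (Fin 1)) := {φ | IsExistsForallType φ ∧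
    ∀ (F : Type) [Field F] (u : ValuationSubring F) (x : Fin 1 → F), ValuedFieldEquiv vK u →
      RingRealize φ x → x 0 ∈ u}
  suffices h : ∃ φ ∈ E, ∀ (F : Type) [Field F] (u : ValuationSubring F) (x : Fin 1 → F),
      ValuedFieldEquiv vK u → x 0 ∈ u → RingRealize φ x by
    obtain ⟨φ, ⟨hφ, hφu⟩, hcov⟩ := h
    obtain ⟨φ', hφ', hr⟩ := hφ.exists_isExistsForall
    refine ⟨φ', hφ', fun F _ u hu => Set.ext fun a => ?_⟩
    let _ := ringStructure F
    exact (hr F fun _ => a).trans ⟨hφu F u _ hu, hcov F u (fun _ => a) hu⟩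
  by_contra! hcon
  let μ : valuedLang.Formula (Fin 1) :=
    Relations.formula₁ (Sum.inr PredRel.mem : valuedLang.Relations 1) (Term.var 0)
  let neg : Language.ring.Formula (Fin 1) → valuedLang.Formula (Fin 1) :=
    fun φ => (LHom.sumInl.onFormula φ).not
  have hneg : ∀ (F : Type) [Field F] (u : ValuationSubring F) (x : Fin 1 → F) φ,
      @Formula.Realize _ _ (valuedStructure u) _ (neg φ) x ↔ ¬ RingRealize φ x := by
    intro F _ u x φ
    let _ := valuedStructure u
    exact Formula.realize_not.trans (not_congr (realize_onFormula_sumInl (u : Set F) φ x))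
  have hμ : ∀ (F : Type) [Field F] (u : ValuationSubring F) (x : Fin 1 → F),
      @Formula.Realize _ _ (valuedStructure u) _ μ x ↔ x 0 ∈ u := by
    intro F _ u x
    let _ := valuedStructure u
    exact Formula.realize_rel₁
  refine absurd (exists_realization_of_finite.{0} vK (insert μ (neg '' E))
    fun Γ₀ hΓ₀ hfin => ?_) ?_
  · obtain ⟨E₀, hE₀, hfin₀, hsub⟩ := exists_finite_subset_insert_image hΓ₀ hfin
    obtain ⟨φ, hφ, hr⟩ := exists_isExistsForallType_sup hfin₀ fun φ hφ => (hE₀ hφ).1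
    obtain ⟨F, _, u, x, hu, hxu, hx⟩ := hcon φ ⟨hφ, fun F _ u x hu hx => by
      obtain ⟨φ', hφ', hx'⟩ := (hr F x).1 hx
      exact (hE₀ hφ').2 F u x hu hx'⟩
    refine ⟨F, inferInstance, u, x, hu, fun φ' hφ' => ?_⟩
    rcases hsub hφ' with rfl | ⟨φ'', hφ'', rfl⟩
    · exact (hμ F u x).2 hxu
    · exact (hneg F u x φ'').2 fun hx' => hx ((hr F x).2 ⟨φ'', hφ'', hx'⟩)
  · rintro ⟨F, _, u, x, hu, hx⟩
    obtain ⟨φ, hφ, hφc, hφu⟩ := exists_isExistsForallType_of_mem hv ht hu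
      ((hμ F u x).1 (hx _ (Set.mem_insert _ _)))
    refine (hneg F u x φ).1 (hx _ (Set.mem_insert_of_mem _ ⟨φ, ⟨hφ, hφu⟩, rfl⟩)) ?_
    rwa [show x = fun _ => x 0 from funext fun i => congrArg x (Subsingleton.elim _ _)]

/-- Whether a formula defines the valuation ring is decided by the elementary theory of the valued
field. -/
theorem ValuedFieldEquiv.definedSet_eq_iff {K L : Type*} [Field K] [Field L]
    {v : ValuationSubring K} {w : ValuationSubring L} (h : ValuedFieldEquiv v w)
    (φ : Language.ring.Formula (Fin 1)) :
    definedSet φ K = (v : Set K) ↔ definedSet φ L = (w : Set L) := by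
  rw [Set.ext_iff, Set.ext_iff]
  have hφ : SameDef (setStructure (v : Set K)) (setStructure (w : Set L))
      (fun z : Empty ⊕ Unit → K => z (Sum.inr ()) ∈ definedSet φ K)
      (fun z => z (Sum.inr ()) ∈ definedSet φ L) :=
    SameDef.comp ⟨LHom.sumInl.onFormula φ, realize_onFormula_sumInl _ φ,
      realize_onFormula_sumInl _ φ⟩ fun _ => Sum.inr ()
  have hmem : SameDef (setStructure (v : Set K)) (setStructure (w : Set L))
      (fun z : Empty ⊕ Unit → K => z (Sum.inr ()) ∈ (v : Set K))
      (fun z => z (Sum.inr ()) ∈ (w : Set L)) := (SameTerm.var _).mem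
  exact SameDef.iff_of_elementarilyEquivalent (SameDef.all
    (((hφ.imp hmem).and (hmem.imp hφ)).congr (fun _ => iff_def.symm) fun _ => iff_def.symm)) h

end CanonicalHenselian

end

theorem mainTheorem3 (K : Type u) [Field K] (vK : ValuationSubring K)
    (hcan : CanonicalHenselian.IsCanonical vK)
    (hH₁ : vK ∈ CanonicalHenselian.H₁ K)
    (ht : ¬ CanonicalHenselian.IsTHenselian (IsLocalRing.ResidueField vK)) :
    ∃ φ : FirstOrder.Language.ring.Formula (Fin 1),
      CanonicalHenselian.IsExistsForall φ ∧
      (∀ (L : Type v) [Field L], CanonicalHenselian.FieldEquiv K L →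
        ∃ vL : ValuationSubring L, CanonicalHenselian.IsCanonical vL ∧
          CanonicalHenselian.definedSet φ L = (vL : Set L)) ∧
      (∀ (L : Type v) [Field L] (w : ValuationSubring L),
        CanonicalHenselian.ValuedFieldEquiv vK w →
          CanonicalHenselian.definedSet φ L = (w : Set L)) := by
  obtain ⟨φ, hφ, hdef⟩ := CanonicalHenselian.exists_defining_formula hH₁ ht
  -- `φ` defines the valuation ring in some model in `Type`, hence in all models
  have hK : CanonicalHenselian.definedSet φ K = (vK : Set K) := by
    obtain ⟨F, _, u, hu⟩ := CanonicalHenselian.exists_valuedFieldEquiv vK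
    exact (hu.definedSet_eq_iff φ).2 (hdef F u hu)
  refine ⟨φ, hφ, fun L _ hL => ?_, fun L _ w hw => (hw.definedSet_eq_iff φ).1 hK⟩
  have h := hL.definedSet φ
  rw [hK] at h
  obtain ⟨vL, hvL⟩ := CanonicalHenselian.exists_valuationSubring_of_elementarilyEquivalent vK h
  rw [← hvL] at h
  have hiso := CanonicalHenselian.ValuedFieldEquiv.hasIsolatedResidueField (w := vL) h hH₁ ht
  exact ⟨vL, CanonicalHenselian.isCanonical_of_residueField hiso.henselian hiso.not_isSepClosed
    hiso.not_isHenselianField, hvL.symm⟩
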